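/- **Setting.** Let $X,Y$ be Banach spaces and let $A$, $B$ generate exponentially stable $C_0$-semigroups $(e^{tA})_{t\ge 0}$ on $X$ and $(e^{tB})_{t\ge 0}$ on $Y$. Let $X_1=D(A)$ and $Y_1=D(B)$ with the norms $\|x\|_{X_1}=\|Ax\|_X$, $\|y\|_{Y_1}=\|By\|_Y$. Let $\gamma,\delta\in(0,1]$ and let $X_\gamma$, $Y_\delta$ be Banach spaces with continuous embeddings $X_1\hookrightarrow X_\gamma\hookrightarrow X$ and $Y_1\hookrightarrow Y_\delta\hookrightarrow Y$ (for instance the interpolation spaces of order $\gamma$, $\delta$). Let $f:X_1\times Y_1\to X_\gamma$ be of class $C^2$ and $g:X_1\times Y_1\to Y_\delta$ of class $C^1$, with $f(0,0)=0$, $g(0,0)=0$, and let $(u^0,v^0)\in X_1\times Y_1$ satisfy $f(u^0,v^0)=0$. Put $$\tilde f(u,v)=f(u,v)-\mathrm D_xf(u^0,v^0)u,\qquad \tilde A_\varepsilon=\varepsilon A+\mathrm D_xf(u^0,v^0),\quad D(\tilde A_\varepsilon)=X_1 .$$ Assume that there are $L_{\tilde f},L_g\ge 0$ such that, for all $x_i\in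 X_1$, $y_i\in Y_1$, $$\|\tilde f(x_1,y_1)-\tilde f(x_2,y_2)\|_{X_\gamma}\le L_{\tilde f}(\|x_1-x_2\|_{X_1}+\|y_1-y_2\|_{Y_1}),$$ $$\|g(x_1,y_1)-g(x_2,y_2)\|_{Y_\delta}\le L_g(\|x_1-x_2\|_{X_1}+\|y_1-y_2\|_{Y_1}).$$ Let $\varepsilon,\zeta>0$ with $\varepsilon\zeta^{-1}<1$ be small enough that the following hold, with $\omega_A\in\mathbb R$, $\lambda_0<0$, $M_A,C_A,M_B,C_B>0$, $0\le N_F^\zeta<N_S^\zeta$ and $\mu:=\varepsilon\omega_A+\lambda_0$. 1. $\mu<0$, and $\tilde A_\varepsilon$ generates a $C_0$-semigroup on $X$ with $\|e^{t\tilde A_\varepsilon}\|_{\mathcal B(X_1)}\le M_Ae^{\mu t}$ and $\|e^{t\tilde A_\varepsilon}\|_{\mathcal B(X_\gamma,X_1)}\le C_At^{\gamma-1}e^{\mu t}$ for $t>0$. 2. $Y=Y_F^\zeta\oplus Y_S^\zeta$ with closed subspaces, $Y_S^\zeta\ne\{0\}$. The projections commute with $B$ on $Y_1$, and $\mathrm{pr}_{Y_S^\zeta}$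 maps $Y_\delta$ boundedly into $Y_1$. There is a $C_0$-group $(e^{tB})_{t\in\mathbb R}$ on $Y_S^\zeta$ that agrees with the given semigroup for $t\ge 0$. For $y_F\in Y_F^\zeta\cap Y_\delta$ and $y_S\in Y_S^\zeta\cap Y_1$, $$\|e^{tB}y_F\|_{Y_1}\le C_Bt^{\delta-1}e^{(N_F^\zeta+\zeta^{-1}\mu)t}\|y_F\|_{Y_\delta}\ (t>0),\qquad \|e^{-tB}y_S\|_{Y_1}\le M_Be^{-(N_S^\zeta+\zeta^{-1}\mu)t}\|y_S\|_{Y_1}\ (t\ge0).$$ 3. With $n_F=\|\mathrm{pr}_{Y_F^\zeta}\|_{\mathcal B(Y_\delta)}$ and $n_S=\|\mathrm{pr}_{Y_S^\zeta}\|_{\mathcal B(Y_\delta,Y_1)}$, $$\frac{2^\gamma L_{\tilde f}C_A\Gamma(\gamma)}{\big(2(\varepsilon\zeta^{-1}-1)\mu+\varepsilon(N_S^\zeta+N_F^\zeta)\big)^\gamma}+\frac{2^\delta L_gn_FC_B\Gamma(\delta)}{(N_S^\zeta-N_F^\zeta)^\delta}+\frac{2L_gn_SM_B\Gamma(\delta)}{N_S^\zeta-N_F^\zeta}<1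 .$$ **The slow manifold.** Let $\eta=\zeta^{-1}\mu+\tfrac12(N_S^\zeta+N_F^\zeta)$ and let $C_\eta$ be the space of continuous $(u,v_F,v_S):(-\infty,0]\to X_1\times(Y_F^\zeta\cap Y_1)\times(Y_S^\zeta\cap Y_1)$ with $\sup_{t\le0}e^{-\eta t}(\|u(t)\|_{X_1}+\|v_F(t)\|_{Y_1}+\|v_S(t)\|_{Y_1})<\infty$. For $y_0\in Y_S^\zeta\cap Y_1$ consider the fixed point equations, for $t\le0$, $$u(t)=\tfrac1\varepsilon\int_{-\infty}^te^{\varepsilon^{-1}(t-s)\tilde A_\varepsilon}\tilde f(u,v_F+v_S)\,ds,\qquad v_F(t)=\int_{-\infty}^te^{(t-s)B}\mathrm{pr}_{Y_F^\zeta}g(u,v_F+v_S)\,ds,$$ $$v_S(t)=e^{tB}y_0+\int_0^te^{(t-s)B}\mathrm{pr}_{Y_S^\zeta}g(u,v_F+v_S)\,ds .$$ **Proposition.** For every $y_0\in Y_S^\zeta\cap Y_1$ these equations have a unique solution in $C_\eta$, so that $h^{\varepsilon,\zeta}(y_0)=(h^{\varepsilon,\zeta}_{X_1}(y_0),h^{\varepsilon,\zeta}_{Y_F^\zeta}(y_0)):=(u(0),v_F(0))$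 is well defined. There are constants $C,c>0$ such that for every $T\ge 0$, every strict solution $(u^\varepsilon,v_F^\varepsilon,v_S^\varepsilon)\in C([0,T];X_1\times Y_1\times Y_1)\cap C^1([0,T];X\times Y\times Y)$, with $v_F^\varepsilon\in Y_F^\zeta$ and $v_S^\varepsilon\in Y_S^\zeta$, of $$\partial_tu^\varepsilon=Au^\varepsilon+\tfrac1\varepsilon f(u^\varepsilon,v_F^\varepsilon+v_S^\varepsilon),\quad \partial_tv_F^\varepsilon=Bv_F^\varepsilon+\mathrm{pr}_{Y_F^\zeta}g(u^\varepsilon,v_F^\varepsilon+v_S^\varepsilon),\quad \partial_tv_S^\varepsilon=Bv_S^\varepsilon+\mathrm{pr}_{Y_S^\zeta}g(u^\varepsilon,v_F^\varepsilon+v_S^\varepsilon),$$ and every $t\in[0,T]$, $$\|u^\varepsilon(t)-h^{\varepsilon,\zeta}_{X_1}(v_S^\varepsilon(t))\|_{X_1}+\|v_F^\varepsilon(t)-h^{\varepsilon,\zeta}_{Y_F^\zeta}(v_S^\varepsilon(t))\|_{Y_1}\le Ce^{-ct}\Big(\|u^\varepsilon(0)-h^{\varepsilon,\zeta}_{X_1}(v_S^\varepsilon(0))\|_{X_1}+\|v_F^\varepsilon(0)-h^{\varepsilon,\zeta}_{Y_F^\zeta}(v_S^\varepsilon(0))\|_{Y_1}\Big).$$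 -/

import Mathlib

open Filter Topology Set MeasureTheory

namespace FastReaction

/-- A strongly continuous semigroup of bounded operators on a Banach space.
Only the values at times `t ≥ 0` are meaningful. -/
structure C0Semigroup (X : Type*) [NormedAddCommGroup X] [NormedSpace ℝ X] where
  op : ℝ → X →L[ℝ] X
  op_zero : op 0 = ContinuousLinearMap.id ℝ X
  op_add : ∀ s t : ℝ, 0 ≤ s → 0 ≤ t → op (s + t) = (op s).comp (op t)
  strongly_continuous : ∀ x : X, Tendsto (fun t => op t x) (𝓝[>] 0) (𝓝 x)

/-- A strongly continuous group of bounded operators. -/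
structure C0Group (X : Type*) [NormedAddCommGroup X] [NormedSpace ℝ X] where
  op : ℝ → X →L[ℝ] X
  op_zero : op 0 = ContinuousLinearMap.id ℝ X
  op_add : ∀ s t : ℝ, op (s + t) = (op s).comp (op t)
  strongly_continuous : ∀ x : X, Tendsto (fun t => op t x) (𝓝 0) (𝓝 x)

/-- The infinitesimal generator of `S` is the operator with domain `range ι` (where `ι` is
injective) that maps `ι z` to `A z`: the limit of `(S t x - x) / t` as `t → 0+` exists exactly for
`x` in the range of `ι`, and it is `A z` for `x = ι z`. -/
def IsGenerator {X X₁ : Type*} [NormedAddCommGroup X] [NormedSpace ℝ X]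
    [NormedAddCommGroup X₁] [NormedSpace ℝ X₁]
    (S : C0Semigroup X) (ι A : X₁ →L[ℝ] X) : Prop :=
  Function.Injective ι ∧
    ∀ x y : X, Tendsto (fun t : ℝ => t⁻¹ • (S.op t x - x)) (𝓝[>] 0) (𝓝 y) ↔
      ∃ z : X₁, ι z = x ∧ A z = y

/-- A Banach space `X` with an exponentially stable `C₀`-semigroup, the domain `X₁` of its
generator `A`, normed by `‖x‖_{X₁} = ‖A x‖_X`, and a Banach space `Xγ` between them, with
continuous embeddings `X₁ ⊆ Xγ ⊆ X` (for instance `X₁` itself, or any interpolation space). -/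
structure Scale (X X₁ Xγ : Type*)
    [NormedAddCommGroup X] [NormedSpace ℝ X] [NormedAddCommGroup X₁] [NormedSpace ℝ X₁]
    [NormedAddCommGroup Xγ] [NormedSpace ℝ Xγ] where
  semigroup : C0Semigroup X
  /-- the embedding of `X₁` into `X` -/
  ι₁ : X₁ →L[ℝ] X
  /-- the generator, as a map from its domain `X₁` to `X` -/
  gen : X₁ →L[ℝ] X
  /-- the embedding of `Xγ` into `X` -/
  ι : Xγ →L[ℝ] X
  /-- the embedding of `X₁` into `Xγ` -/
  κ : X₁ →L[ℝ] Xγ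
  isGenerator : IsGenerator semigroup ι₁ gen
  norm_gen : ∀ x, ‖gen x‖ = ‖x‖
  exp_stable : ∃ M ω : ℝ, 0 < ω ∧ ∀ t, 0 ≤ t → ‖semigroup.op t‖ ≤ M * Real.exp (-ω * t)
  ι_injective : Function.Injective ι
  ι_κ : ∀ x, ι (κ x) = ι₁ x

/-- The data of the fast-reaction system
`∂ₜ u = A u + ε⁻¹ f(u, v)`, `∂ₜ v = B v + g(u, v)`, where `A = spX.gen` and `B = spY.gen`,
and a point `(u⁰, v⁰)` of its critical manifold. -/
structure System (X X₁ Xγ Y Y₁ Yδ : Type*)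
    [NormedAddCommGroup X] [NormedSpace ℝ X] [NormedAddCommGroup X₁] [NormedSpace ℝ X₁]
    [NormedAddCommGroup Xγ] [NormedSpace ℝ Xγ]
    [NormedAddCommGroup Y] [NormedSpace ℝ Y] [NormedAddCommGroup Y₁] [NormedSpace ℝ Y₁]
    [NormedAddCommGroup Yδ] [NormedSpace ℝ Yδ] where
  spX : Scale X X₁ Xγ
  spY : Scale Y Y₁ Yδ
  f : X₁ × Y₁ → Xγ
  g : X₁ × Y₁ → Yδ
  f_contDiff : ContDiff ℝ 2 f
  g_contDiff : ContDiff ℝ 1 g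
  f_zero : f (0, 0) = 0
  g_zero : g (0, 0) = 0
  u₀ : X₁
  v₀ : Y₁
  critical : f (u₀, v₀) = 0

section

variable {X X₁ Xγ Y Y₁ Yδ : Type*}
  [NormedAddCommGroup X] [NormedSpace ℝ X] [NormedAddCommGroup X₁] [NormedSpace ℝ X₁]
  [NormedAddCommGroup Xγ] [NormedSpace ℝ Xγ]
  [NormedAddCommGroup Y] [NormedSpace ℝ Y] [NormedAddCommGroup Y₁] [NormedSpace ℝ Y₁]
  [NormedAddCommGroup Yδ] [NormedSpace ℝ Yδ]

/-- The partial derivative `D_x f(u⁰, v⁰)`. -/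
noncomputable def System.Dxf (S : System X X₁ Xγ Y Y₁ Yδ) : X₁ →L[ℝ] Xγ :=
  fderiv ℝ (fun x => S.f (x, S.v₀)) S.u₀

/-- The modified nonlinearity `f̃(u, v) = f(u, v) - D_x f(u⁰, v⁰) u`. -/
noncomputable def System.fMod (S : System X X₁ Xγ Y Y₁ Yδ) (p : X₁ × Y₁) : Xγ :=
  S.f p - S.Dxf p.1

/-- The modified operator `Ã_ε = ε A + D_x f(u⁰, v⁰)`, with domain `X₁`. -/
noncomputable def System.genMod (S : System X X₁ Xγ Y Y₁ Yδ) (ε : ℝ) : X₁ →L[ℝ] X :=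
  ε • S.spX.gen + S.spX.ι.comp S.Dxf

/-- `Ã_ε` generates a `C₀`-semigroup on `X` with
`‖e^{tÃ_ε}‖_{B(X₁)} ≤ M e^{μt}` and `‖e^{tÃ_ε}‖_{B(Xγ, X₁)} ≤ C t^{γ-1} e^{μt}`. -/
structure ModifiedSemigroup (S : System X X₁ Xγ Y Y₁ Yδ) (ε γ μ M C : ℝ) where
  semigroup : C0Semigroup X
  isGenerator : IsGenerator semigroup S.spX.ι₁ (S.genMod ε)
  bound_one : ∀ t, 0 ≤ t → ∀ x : X₁, ∃ y : X₁,
    S.spX.ι₁ y = semigroup.op t (S.spX.ι₁ x) ∧ ‖y‖ ≤ M * Real.exp (μ * t) * ‖x‖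
  bound_smoothing : ∀ t, 0 < t → ∀ x : Xγ, ∃ y : X₁,
    S.spX.ι₁ y = semigroup.op t (S.spX.ι x) ∧
      ‖y‖ ≤ C * t ^ (γ - 1) * Real.exp (μ * t) * ‖x‖

/-- A splitting `Y = Y_F ⊕ Y_S` into closed subspaces, given by the bounded projection `P` onto
`Y_S = range P` along `Y_F = ker P`. The projection commutes with `B`, it maps `Yδ` boundedly into
`Y₁`, the part of `B` in `Y_S` generates a `C₀`-group that extends `e^{tB}`, and, with
`βF = N_F + ζ⁻¹(εω_A + λ₀)` and `βS = N_S + ζ⁻¹(εω_A + λ₀)`,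
`‖e^{tB} y_F‖_{Y₁} ≤ C_B t^{δ-1} e^{βF t} ‖y_F‖_{Yδ}` and
`‖e^{-tB} y_S‖_{Y₁} ≤ M_B e^{-βS t} ‖y_S‖_{Y₁}`. -/
structure Splitting (sp : Scale Y Y₁ Yδ) (δ βF βS CB MB : ℝ) where
  P : Y →L[ℝ] Y
  P_idem : ∀ y, P (P y) = P y
  P_comm : ∀ y : Y₁, ∃ y' : Y₁, sp.ι₁ y' = P (sp.ι₁ y) ∧ sp.gen y' = P (sp.gen y)
  /-- the projection onto `Y_S`, as a map from `Yδ` to `Y₁` -/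
  Q : Yδ →L[ℝ] Y₁
  ι₁_Q : ∀ y, sp.ι₁ (Q y) = P (sp.ι y)
  group : C0Group P.range
  group_eq : ∀ t, 0 ≤ t → ∀ y : P.range, (group.op t y : Y) = sp.semigroup.op t (y : Y)
  bound_fast : ∀ t, 0 < t → ∀ y : Yδ, P (sp.ι y) = 0 → ∃ y' : Y₁,
    sp.ι₁ y' = sp.semigroup.op t (sp.ι y) ∧
      ‖y'‖ ≤ CB * t ^ (δ - 1) * Real.exp (βF * t) * ‖y‖
  bound_slow : ∀ t, 0 ≤ t → ∀ (y : Y₁) (hy : sp.ι₁ y ∈ P.range), ∃ y' : Y₁,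
    sp.ι₁ y' = (group.op (-t) ⟨sp.ι₁ y, hy⟩ : Y) ∧
      ‖y'‖ ≤ MB * Real.exp (-βS * t) * ‖y‖

namespace Splitting

variable {sp : Scale Y Y₁ Yδ} {δ βF βS CB MB : ℝ}

/-- `y` belongs to `Y_S ∩ Y₁`. -/
def IsSlow (D : Splitting sp δ βF βS CB MB) (y : Y₁) : Prop := sp.ι₁ y ∈ D.P.range

/-- `y` belongs to `Y_F ∩ Y₁`. -/
def IsFast (D : Splitting sp δ βF βS CB MB) (y : Y₁) : Prop := D.P (sp.ι₁ y) = 0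

/-- The projection onto `Y_F`, on `Yδ`. -/
noncomputable def prF (D : Splitting sp δ βF βS CB MB) : Yδ →L[ℝ] Yδ :=
  ContinuousLinearMap.id ℝ Yδ - sp.κ.comp D.Q

/-- `e^{tB} pr_S y` for all real `t`, by means of the group on `Y_S`. -/
noncomputable def slowFlow (D : Splitting sp δ βF βS CB MB) (t : ℝ) (y : Y) : Y :=
  (D.group.op t ⟨D.P y, y, rfl⟩ : Y)

end Splitting

/-- The space `C_η`: continuous functions `w = (u, v_F, v_S)` on `(-∞, 0]` with values in
`X₁ × (Y_F ∩ Y₁) × (Y_S ∩ Y₁)` and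
`sup_{t ≤ 0} e^{-ηt} (‖u‖_{X₁} + ‖v_F‖_{Y₁} + ‖v_S‖_{Y₁}) < ∞`.
Values at positive times are irrelevant. -/
def weightedSpace (X₁ : Type*) [NormedAddCommGroup X₁] {sp : Scale Y Y₁ Yδ}
    {δ βF βS CB MB : ℝ}
    (D : Splitting sp δ βF βS CB MB) (η : ℝ) : Set (ℝ → X₁ × Y₁ × Y₁) :=
  {w | ContinuousOn w (Iic 0) ∧
    (∀ t ≤ 0, D.IsFast (w t).2.1 ∧ D.IsSlow (w t).2.2) ∧
    ∃ K : ℝ, ∀ t ≤ 0,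
      Real.exp (-η * t) * (‖(w t).1‖ + ‖(w t).2.1‖ + ‖(w t).2.2‖) ≤ K}

/-- `w = (u, v_F, v_S)` is, on `(-∞, 0]`, a fixed point of the Lyapunov–Perron operator with
base point `y₀ ∈ Y_S ∩ Y₁`:
`u(t) = ε⁻¹ ∫_{-∞}^t e^{ε⁻¹(t-s)Ã_ε} f̃(w(s)) ds`,
`v_F(t) = ∫_{-∞}^t e^{(t-s)B} pr_F g(w(s)) ds`,
`v_S(t) = e^{tB} y₀ + ∫_0^t e^{(t-s)B} pr_S g(w(s)) ds`.
The integrals are taken in `X` and in `Y`. -/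
def IsFixedPoint (S : System X X₁ Xγ Y Y₁ Yδ) {ε γ μ M C : ℝ}
    (E : ModifiedSemigroup S ε γ μ M C)
    {δ βF βS CB MB : ℝ} (D : Splitting S.spY δ βF βS CB MB) (y₀ : Y₁)
    (w : ℝ → X₁ × Y₁ × Y₁) : Prop :=
  ∀ t ≤ 0,
    S.spX.ι₁ (w t).1 =
      ε⁻¹ • ∫ s in Iic t, E.semigroup.op (ε⁻¹ * (t - s))
        (S.spX.ι (S.fMod ((w s).1, (w s).2.1 + (w s).2.2))) ∧
    S.spY.ι₁ (w t).2.1 =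
      ∫ s in Iic t, S.spY.semigroup.op (t - s)
        (S.spY.ι (D.prF (S.g ((w s).1, (w s).2.1 + (w s).2.2)))) ∧
    S.spY.ι₁ (w t).2.2 =
      D.slowFlow t (S.spY.ι₁ y₀) +
        ∫ s in (0 : ℝ)..t, D.slowFlow (t - s)
          (S.spY.ι (S.g ((w s).1, (w s).2.1 + (w s).2.2)))

/-- The map `h = (h_{X₁}, h_{Y_F}) : Y_S ∩ Y₁ → X₁ × (Y_F ∩ Y₁)` whose graph is the slow manifold:
the first two components at time `0` of the fixed point in `C_η` of the Lyapunov–Perron operator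
with the given base point. -/
noncomputable def slowMap (S : System X X₁ Xγ Y Y₁ Yδ) {ε γ μ M C : ℝ}
    (E : ModifiedSemigroup S ε γ μ M C)
    {δ βF βS CB MB : ℝ} (D : Splitting S.spY δ βF βS CB MB) (η : ℝ) (y₀ : Y₁) : X₁ × Y₁ :=
  let w := Classical.epsilon fun w : ℝ → X₁ × Y₁ × Y₁ =>
    w ∈ weightedSpace X₁ D η ∧ IsFixedPoint S E D y₀ w
  ((w 0).1, (w 0).2.1)

/-- `(u, v_F, v_S)` is a strict solution on `[0, T]` of the split fast-reaction system
`∂ₜ u = A u + ε⁻¹ f(u, v_F + v_S)`, `∂ₜ v_F = B v_F + pr_F g(u, v_F + v_S)`,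
`∂ₜ v_S = B v_S + pr_S g(u, v_F + v_S)`: it is continuous with values in `X₁ × Y₁ × Y₁`, and
differentiable with values in `X × Y × Y` (the derivative is then continuous). -/
structure IsStrictSolution (S : System X X₁ Xγ Y Y₁ Yδ) (ε : ℝ)
    {δ βF βS CB MB : ℝ} (D : Splitting S.spY δ βF βS CB MB) (T : ℝ)
    (u : ℝ → X₁) (vF vS : ℝ → Y₁) : Prop where
  continuousOn_u : ContinuousOn u (Icc 0 T)
  continuousOn_vF : ContinuousOn vF (Icc 0 T)
  continuousOn_vS : ContinuousOn vS (Icc 0 T)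
  fast : ∀ t ∈ Icc 0 T, D.IsFast (vF t)
  slow : ∀ t ∈ Icc 0 T, D.IsSlow (vS t)
  deriv_u : ∀ t ∈ Icc 0 T, HasDerivWithinAt (fun s => S.spX.ι₁ (u s))
    (S.spX.gen (u t) + ε⁻¹ • S.spX.ι (S.f (u t, vF t + vS t))) (Icc 0 T) t
  deriv_vF : ∀ t ∈ Icc 0 T, HasDerivWithinAt (fun s => S.spY.ι₁ (vF s))
    (S.spY.gen (vF t) + S.spY.ι (D.prF (S.g (u t, vF t + vS t)))) (Icc 0 T) t
  deriv_vS : ∀ t ∈ Icc 0 T, HasDerivWithinAt (fun s => S.spY.ι₁ (vS s))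
    (S.spY.gen (vS t) + D.P (S.spY.ι (S.g (u t, vF t + vS t)))) (Icc 0 T) t

end

/-- The constant `L` of the spectral gap condition. Here `μ = εω_A + λ₀`, and `nF`, `nS` are the
operator norms of `pr_F : Yδ → Yδ` and `pr_S : Yδ → Y₁`. -/
noncomputable def gapConst (ε ζ μ γ δ Lf Lg CA CB MB NF NS nF nS : ℝ) : ℝ :=
  2 ^ γ * Lf * CA * Real.Gamma γ / (2 * (ε * ζ⁻¹ - 1) * μ + ε * (NS + NF)) ^ γ
    + 2 ^ δ * (Lg * nF) * CB * Real.Gamma δ / (NS - NF) ^ δ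
    + 2 * (Lg * nS) * MB * Real.Gamma δ / (NS - NF)

end FastReaction

/-!
The three fixed point equations define a Lyapunov–Perron operator on `C_η`. Its integral kernels
take values in `X₁` and `Y₁` and decay faster than `e^{ηt}`, so by Young's inequality the operator
is Lipschitz in the weighted sup norm; the spectral gap condition says that its Lipschitz constant
is less than `1`, and the contraction principle gives the slow manifold.

For the attraction, fix `t` and extend a solution to times before `0` by the fixed point `w₀` with
base point `v_S(0)`, which lies on the slow manifold. Shift time by `t` so that the extended curve
lives on `(-∞, 0]`. It jumps at time `-t` by the initial distance to the slow manifold, and by the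
variation of constants formula it satisfies the fixed point equations with base point `v_S(t)` up to
the free evolution of this jump, which decays like `e^{ηt}`. A contraction controls the distance to
its fixed point by such a defect, so evaluation at time `0` bounds the distance of `u(t)`, `v_F(t)`
to the slow manifold over `v_S(t)`. Since the curve jumps, the operator has to act on
functions with one discontinuity.
-/

namespace FastReaction

section OperatorFamilies

variable {V W : Type*} [NormedAddCommGroup V] [NormedSpace ℝ V]
  [NormedAddCommGroup W] [NormedSpace ℝ W] {K : ℝ → V →L[ℝ] W}

theorem continuousOn_uncurry_of_locally_bounded {U : Set ℝ}
    (hK : ∀ v, ContinuousOn (fun r => K r v) U)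
    (hbdd : ∀ r ∈ U, ∃ M : ℝ, ∀ᶠ s in 𝓝[U] r, ‖K s‖ ≤ M) :
    ContinuousOn (fun p : ℝ × V => K p.1 p.2) (U ×ˢ univ) := by
  rintro ⟨r, v⟩ ⟨hr, -⟩
  obtain ⟨M, hM⟩ := hbdd r hr
  rw [ContinuousWithinAt, nhdsWithin_prod_eq, nhdsWithin_univ]
  have h_orbit : Tendsto (fun p : ℝ × V => K p.1 v) (𝓝[U] r ×ˢ 𝓝 v) (𝓝 (K r v)) :=
    (hK v r hr).tendsto.comp tendsto_fst
  have h_diff : Tendsto (fun p : ℝ × V => K p.1 (p.2 - v)) (𝓝[U] r ×ˢ 𝓝 v) (𝓝 0) := by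
    refine squeeze_zero_norm' (a := fun p : ℝ × V => M * ‖p.2 - v‖) ?_ ?_
    · filter_upwards [tendsto_fst.eventually hM] with p hp
      exact (K p.1).le_of_opNorm_le hp _
    · have h_snd : Tendsto (fun p : ℝ × V => p.2) (𝓝[U] r ×ˢ 𝓝 v) (𝓝 v) := tendsto_snd
      simpa using (h_snd.sub_const v).norm.const_mul M
  simpa using h_orbit.add h_diff

end OperatorFamilies

section Semigroup

variable {X X₁ : Type*} [NormedAddCommGroup X] [NormedSpace ℝ X]
  [NormedAddCommGroup X₁] [NormedSpace ℝ X₁]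

namespace C0Semigroup

theorem op_zero_apply (S : C0Semigroup X) (x : X) : S.op 0 x = x := by
  rw [S.op_zero, ContinuousLinearMap.id_apply]

theorem op_add_apply (S : C0Semigroup X) {s t : ℝ} (hs : 0 ≤ s) (ht : 0 ≤ t) (x : X) :
    S.op (s + t) x = S.op s (S.op t x) := by
  rw [S.op_add s t hs ht, ContinuousLinearMap.comp_apply]

theorem tendsto_nhdsGE_zero (S : C0Semigroup X) (x : X) :
    Tendsto (fun t => S.op t x) (𝓝[≥] 0) (𝓝 x) := by
  rw [← Ioi_insert, nhdsWithin_insert, tendsto_sup, tendsto_pure_left]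
  exact ⟨fun s hs => by simpa only [S.op_zero_apply] using mem_of_mem_nhds hs,
    S.strongly_continuous x⟩

variable [CompleteSpace X]

theorem exists_norm_le_near_zero (S : C0Semigroup X) :
    ∃ d : ℝ, 0 < d ∧ ∃ M : ℝ, ∀ t ∈ Icc 0 d, ‖S.op t‖ ≤ M := by
  by_contra! h
  choose t ht htn using fun n : ℕ => h (1 / ((n : ℝ) + 1)) (by positivity) n
  have ht0 : Tendsto t atTop (𝓝[≥] 0) := tendsto_nhdsWithin_iff.2
    ⟨squeeze_zero (fun n => (ht n).1) (fun n => (ht n).2) tendsto_one_div_add_atTop_nhds_zero_nat,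
      Eventually.of_forall fun n => (ht n).1⟩
  obtain ⟨C, hC⟩ := banach_steinhaus (g := fun n => S.op (t n)) fun x => by
    obtain ⟨C, hC⟩ := ((S.tendsto_nhdsGE_zero x).comp ht0).norm.bddAbove_range
    exact ⟨C, fun n => hC ⟨n, rfl⟩⟩
  obtain ⟨n, hn⟩ := exists_nat_gt C
  exact (hC n).not_gt (hn.trans (htn n))

theorem exists_norm_le (S : C0Semigroup X) (τ : ℝ) :
    ∃ M : ℝ, 0 ≤ M ∧ ∀ t ∈ Icc 0 τ, ‖S.op t‖ ≤ M := by
  obtain ⟨d, hd, M, hM⟩ := S.exists_norm_le_near_zero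
  have hM0 : 0 ≤ M := (norm_nonneg _).trans (hM 0 ⟨le_rfl, hd.le⟩)
  have h_multiples : ∀ n : ℕ, ∃ K : ℝ, 0 ≤ K ∧ ∀ t ∈ Icc 0 (n * d), ‖S.op t‖ ≤ K := by
    intro n
    induction n with
    | zero =>
      refine ⟨‖S.op 0‖, norm_nonneg _, fun t ht => ?_⟩
      rw [le_antisymm (by simpa using ht.2) ht.1]
    | succ n ih =>
      obtain ⟨K, hK0, hK⟩ := ih
      refine ⟨max K (M * K), le_max_of_le_left hK0, fun t ht => ?_⟩
      rcases le_total t (n * d) with h | h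
      · exact le_max_of_le_left (hK t ⟨ht.1, h⟩)
      · refine le_max_of_le_right ?_
        have hnd : 0 ≤ n * d := by positivity
        have h_rest : t - n * d ∈ Icc 0 d := ⟨sub_nonneg.2 h, by
          have := ht.2; push_cast at this; linarith⟩
        rw [← sub_add_cancel t (n * d), S.op_add _ _ h_rest.1 hnd]
        exact (ContinuousLinearMap.opNorm_comp_le _ _).trans
          (mul_le_mul (hM _ h_rest) (hK _ ⟨hnd, le_rfl⟩) (norm_nonneg _) hM0)
  obtain ⟨n, hn⟩ := exists_nat_gt (τ / d)
  obtain ⟨K, hK0, hK⟩ := h_multiples n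
  exact ⟨K, hK0, fun t ht => hK t ⟨ht.1, ht.2.trans ((div_lt_iff₀ hd).1 hn).le⟩⟩

theorem exists_norm_op_sub_op_le (S : C0Semigroup X) (τ : ℝ) : ∃ M : ℝ, ∀ x,
    ∀ s ∈ Icc 0 τ, ∀ t ∈ Icc 0 τ, ‖S.op s x - S.op t x‖ ≤ M * ‖S.op |s - t| x - x‖ := by
  obtain ⟨M, -, hM⟩ := S.exists_norm_le τ
  refine ⟨M, fun x s hs t ht => ?_⟩
  wlog hts : t ≤ s generalizing s t
  · rw [norm_sub_rev, abs_sub_comm]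
    exact this t ht s hs (le_of_not_ge hts)
  have h_split : S.op s x = S.op t (S.op (s - t) x) := by
    rw [← S.op_add_apply ht.1 (sub_nonneg.2 hts), add_sub_cancel]
  rw [abs_of_nonneg (sub_nonneg.2 hts), h_split, ← map_sub]
  exact (S.op t).le_of_opNorm_le (hM t ht) _

theorem continuousOn_orbit (S : C0Semigroup X) (x : X) :
    ContinuousOn (fun t => S.op t x) (Ici 0) := by
  intro t (ht : 0 ≤ t)
  obtain ⟨M, hM⟩ := S.exists_norm_op_sub_op_le (t + 1)
  have h_abs : Tendsto (fun s : ℝ => |s - t|) (𝓝[Ici 0] t) (𝓝[≥] 0) := by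
    simpa using (continuous_sub_right t).abs.continuousWithinAt.tendsto_nhdsWithin
      (s := Ici 0) (x := t) (t := Ici 0) fun s _ => abs_nonneg (s - t)
  have h_zero := (tendsto_iff_norm_sub_tendsto_zero.1
    ((S.tendsto_nhdsGE_zero x).comp h_abs)).const_mul M
  rw [mul_zero] at h_zero
  refine tendsto_iff_norm_sub_tendsto_zero.2 (squeeze_zero' (by simp) ?_ h_zero)
  filter_upwards [self_mem_nhdsWithin, mem_nhdsWithin_of_mem_nhds (Iic_mem_nhds (lt_add_one t))]
    with s h0 h1 using hM x s ⟨h0, h1⟩ t ⟨ht, (lt_add_one t).le⟩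

theorem continuousOn_uncurry (S : C0Semigroup X) :
    ContinuousOn (fun p : ℝ × X => S.op p.1 p.2) (Ici 0 ×ˢ univ) := by
  refine continuousOn_uncurry_of_locally_bounded S.continuousOn_orbit fun r _ => ?_
  obtain ⟨M, -, hM⟩ := S.exists_norm_le (r + 1)
  refine ⟨M, ?_⟩
  filter_upwards [self_mem_nhdsWithin, mem_nhdsWithin_of_mem_nhds (Iic_mem_nhds (lt_add_one r))]
    with s h0 h1 using hM s ⟨h0, h1⟩

theorem continuousOn_op_sub_apply (S : C0Semigroup X) {φ : ℝ → X} {s : Set ℝ} {t : ℝ}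
    (hφ : ContinuousOn φ s) (hs : s ⊆ Iic t) : ContinuousOn (fun r => S.op (t - r) (φ r)) s :=
  S.continuousOn_uncurry.comp (f := fun r => (t - r, φ r)) (by fun_prop)
    fun _ hr => ⟨sub_nonneg.2 (mem_Iic.1 (hs hr)), mem_univ _⟩

theorem intervalIntegrable_orbit (S : C0Semigroup X) (x : X) {a b : ℝ}
    (ha : 0 ≤ a) (hb : 0 ≤ b) : IntervalIntegrable (fun t => S.op t x) volume a b :=
  ((S.continuousOn_orbit x).mono fun _ ht => (le_min ha hb).trans ht.1).intervalIntegrable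

theorem continuous_integral_orbit (S : C0Semigroup X) {t : ℝ} (ht : 0 ≤ t) :
    Continuous fun x => ∫ s in (0 : ℝ)..t, S.op s x := by
  obtain ⟨M, -, hM⟩ := S.exists_norm_le t
  refine (LipschitzWith.of_dist_le' (K := M * t) fun x y => ?_).continuous
  rw [dist_eq_norm, dist_eq_norm, ← intervalIntegral.integral_sub
    (S.intervalIntegrable_orbit x le_rfl ht) (S.intervalIntegrable_orbit y le_rfl ht)]
  calc ‖∫ s in (0 : ℝ)..t, (S.op s x - S.op s y)‖ ≤ M * ‖x - y‖ * |t - 0| := by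
        refine intervalIntegral.norm_integral_le_of_norm_le_const fun s hs => ?_
        rw [uIoc_of_le ht] at hs
        rw [← map_sub]
        exact (S.op s).le_of_opNorm_le (hM s ⟨hs.1.le, hs.2⟩) _
    _ = M * t * ‖x - y‖ := by rw [sub_zero, abs_of_nonneg ht]; ring

theorem hasDerivAt_integral_orbit (S : C0Semigroup X) (x : X) {t : ℝ} (ht : 0 < t) :
    HasDerivAt (fun u => ∫ s in (0 : ℝ)..u, S.op s x) (S.op t x) t := by
  refine intervalIntegral.integral_hasDerivAt_right (S.intervalIntegrable_orbit x le_rfl ht.le) ?_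
    ((S.continuousOn_orbit x).continuousAt (Ici_mem_nhds ht))
  exact ((S.continuousOn_orbit x).mono Ioi_subset_Ici_self).stronglyMeasurableAtFilter isOpen_Ioi
    t ht

theorem tendsto_average (S : C0Semigroup X) (x : X) :
    Tendsto (fun h : ℝ => h⁻¹ • ∫ s in (0 : ℝ)..h, S.op s x) (𝓝[>] 0) (𝓝 x) := by
  have h_deriv : HasDerivWithinAt (fun u => ∫ s in (0 : ℝ)..u, S.op s x) (S.op 0 x) (Ici 0) 0 := by
    refine intervalIntegral.integral_hasDerivWithinAt_right (by simp) (t := Ioi 0) ?_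
      ((S.continuousOn_orbit x 0 self_mem_Ici).mono Ioi_subset_Ici_self)
    exact ((S.continuousOn_orbit x).mono
      Ioi_subset_Ici_self).stronglyMeasurableAtFilter_nhdsWithin measurableSet_Ioi 0
  simpa [slope_fun_def, S.op_zero_apply] using hasDerivWithinAt_iff_tendsto_slope.1 h_deriv

theorem op_integral_orbit (S : C0Semigroup X) (x : X) {k t : ℝ} (hk : 0 ≤ k) (ht : 0 ≤ t) :
    S.op k (∫ s in (0 : ℝ)..t, S.op s x) = ∫ s in k..(t + k), S.op s x := by
  calc S.op k (∫ s in (0 : ℝ)..t, S.op s x) = ∫ s in (0 : ℝ)..t, S.op k (S.op s x) :=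
        ((S.op k).intervalIntegral_comp_comm (S.intervalIntegrable_orbit x le_rfl ht)).symm
    _ = ∫ s in (0 : ℝ)..t, S.op (s + k) x := by
        refine intervalIntegral.integral_congr fun s hs => ?_
        rw [uIcc_of_le ht] at hs
        rw [add_comm, S.op_add_apply hk hs.1]
    _ = ∫ s in k..(t + k), S.op s x := by
        rw [intervalIntegral.integral_comp_add_right (fun s => S.op s x), zero_add]

theorem op_integral_orbit_sub (S : C0Semigroup X) (x : X) {k t : ℝ} (hk : 0 ≤ k) (ht : 0 ≤ t) :
    S.op k (∫ s in (0 : ℝ)..t, S.op s x) - ∫ s in (0 : ℝ)..t, S.op s x =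
      (∫ s in t..(t + k), S.op s x) - ∫ s in (0 : ℝ)..k, S.op s x := by
  have h_int : ∀ a b, 0 ≤ a → 0 ≤ b → IntervalIntegrable (fun s => S.op s x) volume a b :=
    fun a b => S.intervalIntegrable_orbit x
  have hkt : 0 ≤ t + k := add_nonneg ht hk
  rw [S.op_integral_orbit x hk ht,
    ← intervalIntegral.integral_interval_sub_left (h_int 0 _ le_rfl hkt) (h_int 0 k le_rfl hk),
    ← intervalIntegral.integral_interval_sub_left (h_int 0 _ le_rfl hkt) (h_int 0 t le_rfl ht)]
  abel

end C0Semigroup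

namespace IsGenerator

variable {S : C0Semigroup X} {ι A : X₁ →L[ℝ] X}

theorem tendsto_quotient (h : IsGenerator S ι A) (z : X₁) :
    Tendsto (fun t : ℝ => t⁻¹ • (S.op t (ι z) - ι z)) (𝓝[>] 0) (𝓝 (A z)) :=
  (h.2 _ _).2 ⟨z, rfl, rfl⟩

theorem exists_op (h : IsGenerator S ι A) {t : ℝ} (ht : 0 ≤ t) (z : X₁) :
    ∃ z' : X₁, ι z' = S.op t (ι z) ∧ A z' = S.op t (A z) := by
  refine (h.2 _ _).1 ((((S.op t).continuous.tendsto _).comp (h.tendsto_quotient z)).congr' ?_)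
  filter_upwards [self_mem_nhdsWithin] with s (hs : 0 < s)
  simp only [Function.comp, map_smul, map_sub]
  rw [← S.op_add_apply ht hs.le, ← S.op_add_apply hs.le ht, add_comm]

theorem hasDerivWithinAt_orbit (h : IsGenerator S ι A) {t : ℝ} (ht : 0 ≤ t) (z : X₁) :
    HasDerivWithinAt (fun s => S.op s (ι z)) (S.op t (A z)) (Ioi t) t := by
  obtain ⟨z', hz', hAz'⟩ := h.exists_op ht z
  have h_quot := h.tendsto_quotient z'
  rw [hz', hAz'] at h_quot
  have h_shift : Tendsto (fun s : ℝ => s - t) (𝓝[>] t) (𝓝[>] 0) := by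
    simpa using (continuous_sub_right t).continuousWithinAt.tendsto_nhdsWithin
      (s := Ioi t) (x := t) (t := Ioi 0) fun s hs => sub_pos.2 hs
  rw [hasDerivWithinAt_iff_tendsto_slope' self_notMem_Ioi]
  refine (h_quot.comp h_shift).congr' ?_
  filter_upwards [self_mem_nhdsWithin] with s (hs : t < s)
  simp only [Function.comp, slope_def_module]
  rw [← S.op_add_apply (sub_pos.2 hs).le ht, sub_add_cancel]

/-- The semigroup on the domain of its generator; the value at negative times is junk. -/
noncomputable def domainOp (h : IsGenerator S ι A) (t : ℝ) (z : X₁) : X₁ :=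
  if ht : 0 ≤ t then (h.exists_op ht z).choose else 0

theorem ι_domainOp (h : IsGenerator S ι A) {t : ℝ} (ht : 0 ≤ t) (z : X₁) :
    ι (h.domainOp t z) = S.op t (ι z) := by
  rw [domainOp, dif_pos ht]; exact (h.exists_op ht z).choose_spec.1

theorem A_domainOp (h : IsGenerator S ι A) {t : ℝ} (ht : 0 ≤ t) (z : X₁) :
    A (h.domainOp t z) = S.op t (A z) := by
  rw [domainOp, dif_pos ht]; exact (h.exists_op ht z).choose_spec.2

theorem domainOp_zero (h : IsGenerator S ι A) (z : X₁) : h.domainOp 0 z = z :=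
  h.1 (by rw [h.ι_domainOp le_rfl, S.op_zero_apply])

variable [CompleteSpace X]

theorem integral_orbit (h : IsGenerator S ι A) {t : ℝ} (ht : 0 ≤ t) (z : X₁) :
    ∫ s in (0 : ℝ)..t, S.op s (A z) = S.op t (ι z) - ι z := by
  rw [intervalIntegral.integral_eq_sub_of_hasDeriv_right_of_le (f := fun s => S.op s (ι z)) ht
    ((S.continuousOn_orbit _).mono Icc_subset_Ici_self)
    (fun s hs => h.hasDerivWithinAt_orbit hs.1.le z) (S.intervalIntegrable_orbit _ le_rfl ht),
    S.op_zero_apply]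

theorem hasDerivAt_orbit (h : IsGenerator S ι A) {t : ℝ} (ht : 0 < t) (z : X₁) :
    HasDerivAt (fun s => S.op s (ι z)) (S.op t (A z)) t := by
  refine ((S.hasDerivAt_integral_orbit (A z) ht).add_const (ι z)).congr_of_eventuallyEq ?_
  filter_upwards [Ioi_mem_nhds ht] with s hs
  rw [h.integral_orbit (le_of_lt hs), sub_add_cancel]

theorem integral_mem_range (h : IsGenerator S ι A) {t : ℝ} (ht : 0 < t) (x : X) :
    ∫ s in (0 : ℝ)..t, S.op s x ∈ range ι := by
  suffices h_lim : Tendsto (fun k : ℝ => k⁻¹ • (S.op k (∫ s in (0 : ℝ)..t, S.op s x) -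
      ∫ s in (0 : ℝ)..t, S.op s x)) (𝓝[>] 0) (𝓝 (S.op t x - x)) by
    obtain ⟨z, hz, -⟩ := (h.2 _ _).1 h_lim
    exact ⟨z, hz⟩
  have h_shift : Tendsto (fun k : ℝ => t + k) (𝓝[>] 0) (𝓝[≠] t) := by
    simpa using (continuous_const_add t).continuousWithinAt.tendsto_nhdsWithin
      (s := Ioi 0) (x := 0) (t := {t}ᶜ) fun k (hk : 0 < k) => by simp [hk.ne']
  have h_slope := (hasDerivAt_iff_tendsto_slope.1 (S.hasDerivAt_integral_orbit x ht)).comp h_shift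
  refine (h_slope.sub (S.tendsto_average x)).congr' ?_
  filter_upwards [self_mem_nhdsWithin] with k (hk : 0 < k)
  rw [S.op_integral_orbit_sub x hk.le ht.le, smul_sub]
  simp only [Function.comp, slope_def_module, add_sub_cancel_left]
  rw [intervalIntegral.integral_interval_sub_left
    (S.intervalIntegrable_orbit x le_rfl (by positivity))
    (S.intervalIntegrable_orbit x le_rfl ht.le)]

theorem denseRange (h : IsGenerator S ι A) : DenseRange ι := by
  intro x
  refine mem_closure_of_tendsto (S.tendsto_average x) ?_
  filter_upwards [self_mem_nhdsWithin] with t (ht : 0 < t)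
  obtain ⟨z, hz⟩ := h.integral_mem_range ht x
  exact ⟨t⁻¹ • z, by rw [map_smul, hz]⟩

theorem mem_range_graph_iff (h : IsGenerator S ι A) {p : X × X} :
    p ∈ range (ι.prod A) ↔
      ∀ t : ℝ, 0 ≤ t → ∫ s in (0 : ℝ)..t, S.op s p.2 = S.op t p.1 - p.1 := by
  constructor
  · rintro ⟨z, rfl⟩ t ht
    exact h.integral_orbit ht z
  · intro hp
    obtain ⟨z, hz, hAz⟩ := (h.2 p.1 p.2).1 <| (S.tendsto_average p.2).congr' <| by
      filter_upwards [self_mem_nhdsWithin] with t (ht : 0 < t)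
      rw [hp t ht.le]
    exact ⟨z, Prod.ext hz hAz⟩

theorem isClosed_range_graph (h : IsGenerator S ι A) : IsClosed (range (ι.prod A)) := by
  have h_eq : range (ι.prod A) = ⋂ t : ℝ, ⋂ _ : 0 ≤ t,
      {p : X × X | ∫ s in (0 : ℝ)..t, S.op s p.2 = S.op t p.1 - p.1} := by
    ext p
    simp only [h.mem_range_graph_iff, mem_iInter, mem_ofPred_eq]
  rw [h_eq]
  exact isClosed_iInter fun t => isClosed_iInter fun ht =>
    isClosed_eq ((S.continuous_integral_orbit ht).comp continuous_snd) (by fun_prop)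

theorem isInducing_graph [CompleteSpace X₁] (h : IsGenerator S ι A) : IsInducing (ι.prod A) := by
  have h_inj : Function.Injective (ι.prod A) := fun x y hxy => h.1 (congrArg Prod.fst hxy)
  obtain ⟨K, hK⟩ := (ι.prod A).antilipschitz_of_injective_of_isClosed_range h_inj
    h.isClosed_range_graph
  exact (hK.isUniformInducing (ι.prod A).uniformContinuous).isInducing

theorem continuousOn_domainOp [CompleteSpace X₁] (h : IsGenerator S ι A) (z : X₁) :
    ContinuousOn (fun t => h.domainOp t z) (Ici 0) := by
  rw [h.isInducing_graph.continuousOn_iff]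
  refine ((S.continuousOn_orbit (ι z)).prodMk (S.continuousOn_orbit (A z))).congr fun t ht => ?_
  rw [Function.comp, ContinuousLinearMap.prod_apply, h.ι_domainOp ht, h.A_domainOp ht]

theorem hasDerivAt_op_sub_apply (h : IsGenerator S ι A) {y : ℝ → X₁} {y' : X} {r t : ℝ}
    (hrt : r < t) (hy : HasDerivAt (fun s => ι (y s)) y' r) :
    HasDerivAt (fun s => S.op (t - s) (ι (y s))) (S.op (t - r) (y' - A (y r))) r := by
  have h_orbit : HasDerivAt (fun s => S.op (t - s) (ι (y r))) (-S.op (t - r) (A (y r))) r := by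
    have h_comp := (h.hasDerivAt_orbit (sub_pos.2 hrt) (y r)).scomp r
      ((hasDerivAt_id r).const_sub t)
    rwa [neg_smul, one_smul] at h_comp
  rw [hasDerivAt_iff_tendsto_slope] at hy h_orbit ⊢
  have h_slope : Tendsto (fun s => S.op (t - s) (slope (fun s => ι (y s)) r s)) (𝓝[≠] r)
      (𝓝 (S.op (t - r) y')) := by
    refine (S.continuousOn_uncurry (t - r, y') ⟨(sub_pos.2 hrt).le, mem_univ _⟩).tendsto.comp
      (f := fun s => (t - s, slope (fun s => ι (y s)) r s))
      (tendsto_nhdsWithin_iff.2 ⟨Tendsto.prodMk_nhds ?_ hy, ?_⟩)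
    · exact ((continuous_sub_left t).tendsto r).mono_left nhdsWithin_le_nhds
    · filter_upwards [mem_nhdsWithin_of_mem_nhds (Iio_mem_nhds hrt)] with s (hs : s < t)
        using ⟨(sub_pos.2 hs).le, mem_univ _⟩
  rw [map_sub, sub_eq_add_neg]
  refine (h_slope.add h_orbit).congr fun s => ?_
  simp only [slope_def_module, map_smul, map_sub]
  rw [← smul_add]
  congr 1
  abel

theorem variation_of_constants (h : IsGenerator S ι A) {T : ℝ} {y : ℝ → X₁} {φ : ℝ → X}
    (hφ : ContinuousOn φ (Icc 0 T))
    (hy : ∀ t ∈ Icc 0 T, HasDerivWithinAt (fun s => ι (y s)) (A (y t) + φ t) (Icc 0 T) t)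
    {t : ℝ} (ht : t ∈ Icc 0 T) :
    ι (y t) = S.op t (ι (y 0)) + ∫ s in (0 : ℝ)..t, S.op (t - s) (φ s) := by
  have h_sub : Icc 0 t ⊆ Icc 0 T := Icc_subset_Icc_right ht.2
  have h_cont : ContinuousOn (fun s => ι (y s)) (Icc 0 t) := fun s hs =>
    (hy s (h_sub hs)).continuousWithinAt.mono h_sub
  have h_deriv : ∀ r ∈ Ioo 0 t,
      HasDerivAt (fun s => S.op (t - s) (ι (y s))) (S.op (t - r) (φ r)) r := fun r hr => by
    simpa only [add_sub_cancel_left] using h.hasDerivAt_op_sub_apply hr.2 <|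
      (hy r (h_sub (Ioo_subset_Icc_self hr))).hasDerivAt (Icc_mem_nhds hr.1 (hr.2.trans_le ht.2))
  rw [intervalIntegral.integral_eq_sub_of_hasDerivAt_of_le ht.1
    (S.continuousOn_op_sub_apply h_cont Icc_subset_Iic_self) h_deriv
    ((S.continuousOn_op_sub_apply (hφ.mono h_sub) Icc_subset_Iic_self).intervalIntegrable_of_Icc
      ht.1), sub_self, S.op_zero_apply, sub_zero, add_sub_cancel]

end IsGenerator

theorem tendsto_const_mul_nhdsGT_zero {c : ℝ} (hc : 0 < c) :
    Tendsto (fun s : ℝ => c * s) (𝓝[>] 0) (𝓝[>] 0) := by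
  simpa using (continuous_const_mul c).continuousWithinAt.tendsto_nhdsWithin
    (s := Ioi 0) (x := 0) (t := Ioi 0) fun s hs => mul_pos hc hs

/-- The semigroup `t ↦ e^{ctA}`. -/
def C0Semigroup.rescale (S : C0Semigroup X) (c : ℝ) (hc : 0 < c) : C0Semigroup X where
  op t := S.op (c * t)
  op_zero := by rw [mul_zero, S.op_zero]
  op_add s t hs ht := by rw [mul_add, S.op_add _ _ (by positivity) (by positivity)]
  strongly_continuous x := (S.strongly_continuous x).comp (tendsto_const_mul_nhdsGT_zero hc)

theorem C0Semigroup.tendsto_quotient_rescale_iff {S : C0Semigroup X} {c : ℝ} (hc : 0 < c)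
    {x y : X} :
    Tendsto (fun t : ℝ => t⁻¹ • ((S.rescale c hc).op t x - x)) (𝓝[>] 0) (𝓝 y) ↔
      Tendsto (fun t : ℝ => t⁻¹ • (S.op t x - x)) (𝓝[>] 0) (𝓝 (c⁻¹ • y)) := by
  constructor
  · intro h
    refine ((h.comp (tendsto_const_mul_nhdsGT_zero (inv_pos.2 hc))).const_smul c⁻¹).congr
      fun t => ?_
    simp only [Function.comp, C0Semigroup.rescale, mul_inv_cancel_left₀ hc.ne', smul_smul]
    congr 1
    field_simp
  · intro h
    have h_lim := (h.comp (tendsto_const_mul_nhdsGT_zero hc)).const_smul c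
    rw [smul_inv_smul₀ hc.ne'] at h_lim
    refine h_lim.congr fun t => ?_
    simp only [Function.comp, C0Semigroup.rescale, smul_smul]
    congr 1
    field_simp

theorem IsGenerator.rescale {S : C0Semigroup X} {ι A : X₁ →L[ℝ] X} (h : IsGenerator S ι A) {c : ℝ}
    (hc : 0 < c) : IsGenerator (S.rescale c hc) ι (c • A) := by
  refine ⟨h.1, fun x y => ?_⟩
  rw [C0Semigroup.tendsto_quotient_rescale_iff, h.2]
  refine exists_congr fun z => and_congr_right fun _ => ?_
  rw [eq_inv_smul_iff₀ hc.ne', _root_.smul_apply]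

end Semigroup

section Admissible

variable {E F : Type*} [NormedAddCommGroup E] [NormedAddCommGroup F] {η : ℝ}

/-- Functions on `(-∞, 0]` that are `O(e^{ηt})` and continuous except possibly at one point. The
exceptional point leaves room for the jump in a trajectory that is pieced together from two. -/
def Admissible (η : ℝ) (w : ℝ → E) : Prop :=
  (∃ a, ContinuousOn w (Iic 0 \ {a})) ∧ ∃ D, ∀ t ≤ 0, ‖w t‖ ≤ D * Real.exp (η * t)

namespace Admissible

theorem zero : Admissible η (0 : ℝ → E) :=
  ⟨⟨0, continuousOn_const⟩, 0, fun t _ => by simp⟩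

theorem of_continuousOn {D : ℝ} {w : ℝ → E} (hw : ContinuousOn w (Iic 0))
    (hD : ∀ t ≤ 0, ‖w t‖ ≤ D * Real.exp (η * t)) : Admissible η w :=
  ⟨⟨0, hw.mono sdiff_subset⟩, D, hD⟩

theorem comp_lipschitz {w : ℝ → E} (hw : Admissible η w) {N : E → F} {l : NNReal}
    (hN : LipschitzWith l N) (hN0 : N 0 = 0) : Admissible η fun t => N (w t) := by
  obtain ⟨⟨a, ha⟩, D, hD⟩ := hw
  refine ⟨⟨a, hN.continuous.comp_continuousOn ha⟩, l * D, fun t ht => ?_⟩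
  calc ‖N (w t)‖ ≤ l * ‖w t‖ := by simpa [hN0] using hN.norm_sub_le (w t) 0
    _ ≤ l * (D * Real.exp (η * t)) := by gcongr; exact hD t ht
    _ = l * D * Real.exp (η * t) := by ring

theorem exists_continuousAt_indicator {w : ℝ → E} (hw : Admissible η w) :
    ∃ a, ∀ t, t ≠ 0 → t ≠ a → ContinuousAt ((Iic (0 : ℝ)).indicator w) t := by
  obtain ⟨a, ha⟩ := hw.1
  refine ⟨a, fun t ht0 hta => ?_⟩
  rcases lt_or_gt_of_ne ht0 with hlt | hgt
  · have h_nhds : Iio (0 : ℝ) \ {a} ∈ 𝓝 t :=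
      (isOpen_Iio.sdiff isClosed_singleton).mem_nhds ⟨hlt, hta⟩
    refine ((ha.mono (sdiff_subset_sdiff_left Iio_subset_Iic_self)).continuousAt h_nhds).congr ?_
    filter_upwards [h_nhds] with s hs
    rw [indicator_of_mem (Iio_subset_Iic_self hs.1)]
  · refine (continuousAt_const (y := (0 : E))).congr ?_
    filter_upwards [Ioi_mem_nhds hgt] with s (hs : 0 < s)
    rw [indicator_of_notMem (notMem_Iic.2 hs)]

end Admissible

end Admissible

section Green

variable {V W : Type*} [NormedAddCommGroup V] [NormedSpace ℝ V]
  [NormedAddCommGroup W] [NormedSpace ℝ W]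

/-- An operator-valued kernel, strongly continuous away from `0` and dominated by `k`, for which
convolution over `(-∞, 0]` has norm at most `L` in the sup norm with weight `e^{-ηt}`. The
dominating function is part of the data because `r ↦ ‖K r‖` need not be continuous. -/
structure IsGreenKernel (K : ℝ → V →L[ℝ] W) (k : ℝ → ℝ) (η L : ℝ) : Prop where
  continuousOn_apply : ∀ v, ContinuousOn (fun r => K r v) {0}ᶜ
  continuousOn_bound : ContinuousOn k {0}ᶜ
  norm_le : ∀ r, ‖K r‖ ≤ k r
  integrable : Integrable fun r => k r * Real.exp (-η * r)
  integral_le : ∫ r, k r * Real.exp (-η * r) ≤ L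

/-- Convolution with an operator-valued kernel over the half-line `(-∞, 0]`. -/
noncomputable def conv (K : ℝ → V →L[ℝ] W) (φ : ℝ → V) (t : ℝ) : W :=
  ∫ s in Iic (0 : ℝ), K (t - s) (φ s)

namespace IsGreenKernel

variable {K : ℝ → V →L[ℝ] W} {k : ℝ → ℝ} {η L : ℝ} {φ ψ : ℝ → V}

theorem bound_nonneg (h : IsGreenKernel K k η L) (r : ℝ) : 0 ≤ k r :=
  (norm_nonneg _).trans (h.norm_le r)

theorem nonneg (h : IsGreenKernel K k η L) : 0 ≤ L :=
  (integral_nonneg fun r => mul_nonneg (h.bound_nonneg r) (Real.exp_pos _).le).trans h.integral_le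

theorem norm_apply_le (h : IsGreenKernel K k η L) (r : ℝ) {v : V} {c : ℝ} (hv : ‖v‖ ≤ c) :
    ‖K r v‖ ≤ k r * c :=
  ((K r).le_of_opNorm_le (h.norm_le r) v).trans
    (mul_le_mul_of_nonneg_left hv (h.bound_nonneg r))

theorem continuousOn_uncurry (h : IsGreenKernel K k η L) :
    ContinuousOn (fun p : ℝ × V => K p.1 p.2) ({0}ᶜ ×ˢ univ) := by
  refine continuousOn_uncurry_of_locally_bounded h.continuousOn_apply fun r hr => ⟨k r + 1, ?_⟩
  filter_upwards [(h.continuousOn_bound r hr).eventually_le_const (lt_add_one (k r))] with s hs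
  exact (h.norm_le s).trans hs

theorem bound_mul_exp_eq (k : ℝ → ℝ) (η D t s : ℝ) :
    k (t - s) * (D * Real.exp (η * s)) =
      k (t - s) * Real.exp (-η * (t - s)) * (D * Real.exp (η * t)) := by
  have h_exp : Real.exp (η * s) = Real.exp (-η * (t - s)) * Real.exp (η * t) := by
    rw [← Real.exp_add]; ring_nf
  rw [h_exp]
  ring

theorem integrable_bound (h : IsGreenKernel K k η L) (t D : ℝ) :
    Integrable fun s => k (t - s) * (D * Real.exp (η * s)) := by
  simp_rw [bound_mul_exp_eq]
  exact (h.integrable.comp_sub_left t).mul_const _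

theorem integral_bound_le (h : IsGreenKernel K k η L) (t : ℝ) {D : ℝ} (hD : 0 ≤ D) :
    ∫ s in Iic (0 : ℝ), k (t - s) * (D * Real.exp (η * s)) ≤ L * D * Real.exp (η * t) := by
  calc ∫ s in Iic (0 : ℝ), k (t - s) * (D * Real.exp (η * s))
      ≤ ∫ s, k (t - s) * (D * Real.exp (η * s)) :=
        setIntegral_le_integral (h.integrable_bound t D) <| Eventually.of_forall fun s =>
          mul_nonneg (h.bound_nonneg _) (mul_nonneg hD (Real.exp_pos _).le)
    _ = (∫ r, k r * Real.exp (-η * r)) * (D * Real.exp (η * t)) := by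
        simp_rw [bound_mul_exp_eq]
        rw [integral_mul_const,
          integral_sub_left_eq_self (fun r => k r * Real.exp (-η * r)) volume t]
    _ ≤ L * (D * Real.exp (η * t)) := mul_le_mul_of_nonneg_right h.integral_le (by positivity)
    _ = L * D * Real.exp (η * t) := by ring

theorem integrableOn (h : IsGreenKernel K k η L) (hφ : Admissible η φ) (t : ℝ) :
    IntegrableOn (fun s => K (t - s) (φ s)) (Iic 0) := by
  obtain ⟨⟨a, ha⟩, D, hD⟩ := hφ
  have h_ae : (Iic (0 : ℝ) \ {a, t} : Set ℝ) =ᵐ[volume] Iic 0 :=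
    sdiff_null_ae_eq_self ((Set.toFinite _).measure_zero _)
  have h_cont : ContinuousOn (fun s => K (t - s) (φ s)) (Iic 0 \ {a, t}) :=
    h.continuousOn_uncurry.comp (f := fun s => (t - s, φ s))
      ((by fun_prop : Continuous fun s : ℝ => t - s).continuousOn.prodMk
        (ha.mono (sdiff_subset_sdiff_right (by simp))))
      fun s hs => ⟨fun hst => hs.2 (Or.inr (sub_eq_zero.1 hst).symm), mem_univ _⟩
  refine Integrable.mono' (h.integrable_bound t D).integrableOn ?_ ?_
  · rw [← Measure.restrict_congr_set h_ae]
    exact h_cont.aestronglyMeasurable (measurableSet_Iic.diff (Set.toFinite _).measurableSet)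
  · filter_upwards [ae_restrict_mem measurableSet_Iic] with s hs
    exact h.norm_apply_le _ (hD s hs)

theorem norm_conv_le (h : IsGreenKernel K k η L) {D : ℝ} (hD : 0 ≤ D)
    (hφ : ∀ s ≤ 0, ‖φ s‖ ≤ D * Real.exp (η * s)) (t : ℝ) :
    ‖conv K φ t‖ ≤ L * D * Real.exp (η * t) := by
  refine (norm_integral_le_of_norm_le (h.integrable_bound t D).integrableOn ?_).trans
    (h.integral_bound_le t hD)
  filter_upwards [ae_restrict_mem measurableSet_Iic] with s hs
  exact h.norm_apply_le _ (hφ s hs)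

theorem conv_sub (h : IsGreenKernel K k η L) (hφ : Admissible η φ) (hψ : Admissible η ψ) (t : ℝ) :
    conv K φ t - conv K ψ t = conv K (φ - ψ) t := by
  simp only [conv, Pi.sub_apply, map_sub]
  exact (integral_sub (h.integrableOn hφ t) (h.integrableOn hψ t)).symm

theorem map_conv [CompleteSpace W] {Z : Type*} [NormedAddCommGroup Z] [NormedSpace ℝ Z]
    [CompleteSpace Z] (h : IsGreenKernel K k η L) (hφ : Admissible η φ) (j : W →L[ℝ] Z) (t : ℝ) :
    j (conv K φ t) = ∫ s in Iic (0 : ℝ), j (K (t - s) (φ s)) :=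
  (j.integral_comp_comm (h.integrableOn hφ t)).symm

theorem conv_eq_integral (K : ℝ → V →L[ℝ] W) (φ : ℝ → V) (t : ℝ) :
    conv K φ t = ∫ r, K r ((Iic (0 : ℝ)).indicator φ (t - r)) := by
  rw [conv, ← integral_indicator measurableSet_Iic,
    ← integral_sub_left_eq_self (fun r => K r ((Iic (0 : ℝ)).indicator φ (t - r))) volume t]
  refine integral_congr_ae (Eventually.of_forall fun s => ?_)
  by_cases hs : s ∈ Iic (0 : ℝ) <;> simp [hs]

theorem integrable_indicator (h : IsGreenKernel K k η L) (hφ : Admissible η φ) (t : ℝ) :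
    Integrable fun r => K r ((Iic (0 : ℝ)).indicator φ (t - r)) := by
  refine (((integrable_indicator_iff measurableSet_Iic).2
    (h.integrableOn hφ t)).comp_sub_left t).congr (Eventually.of_forall fun r => ?_)
  by_cases hr : t - r ∈ Iic (0 : ℝ)
  · simp only [indicator_of_mem hr, sub_sub_cancel]
  · simp only [indicator_of_notMem hr, map_zero]

theorem exp_mul_sub_le {t t₀ : ℝ} (η r : ℝ) (ht : |t - t₀| < 1) :
    Real.exp (η * (t - r)) ≤ Real.exp (-η * r) * Real.exp (|η| * (|t₀| + 1)) := by
  have h_abs : |t| ≤ |t₀| + 1 := by linarith [abs_sub_abs_le_abs_sub t t₀]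
  have h_mul : η * t ≤ |η| * (|t₀| + 1) :=
    (le_abs_self _).trans (by rw [abs_mul]; gcongr)
  rw [← Real.exp_add]
  exact Real.exp_le_exp.2 (by linarith)

theorem continuous_conv (h : IsGreenKernel K k η L) (hφ : Admissible η φ) :
    Continuous (conv K φ) := by
  rw [funext (conv_eq_integral K φ), continuous_iff_continuousAt]
  intro t₀
  obtain ⟨a, ha⟩ := hφ.exists_continuousAt_indicator
  obtain ⟨D, hD⟩ := hφ.2
  have hD0 : 0 ≤ D := by simpa using (norm_nonneg _).trans (hD 0 le_rfl)
  refine continuousAt_of_dominated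
    (bound := fun r => k r * Real.exp (-η * r) * (D * Real.exp (|η| * (|t₀| + 1))))
    (Eventually.of_forall fun t => (h.integrable_indicator hφ t).aestronglyMeasurable) ?_
    (h.integrable.mul_const _) ?_
  · filter_upwards [Metric.ball_mem_nhds t₀ one_pos] with t ht
    refine Eventually.of_forall fun r => ?_
    rw [mul_assoc]
    refine h.norm_apply_le r ?_
    by_cases hr : t - r ∈ Iic (0 : ℝ)
    · rw [indicator_of_mem hr, mul_left_comm]
      exact (hD _ hr).trans (mul_le_mul_of_nonneg_left (exp_mul_sub_le η r ht) hD0)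
    · rw [indicator_of_notMem hr, norm_zero]
      positivity
  · have h_null : ({t₀, t₀ - a} : Set ℝ)ᶜ ∈ ae volume :=
      compl_mem_ae_iff.2 ((Set.toFinite _).measure_zero _)
    filter_upwards [h_null] with r hr
    simp only [mem_compl_iff, mem_insert_iff, mem_singleton_iff, not_or] at hr
    obtain ⟨hrt, hra⟩ := hr
    have h_ind : ContinuousAt (fun t => (Iic (0 : ℝ)).indicator φ (t - r)) t₀ :=
      (ha (t₀ - r) (sub_ne_zero.2 (Ne.symm hrt)) fun h_eq => hra (by linarith)).comp
        (f := fun t => t - r) (continuous_sub_right r).continuousAt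
    exact (K r).continuous.continuousAt.comp h_ind

variable {E : Type*} [NormedAddCommGroup E] {N : E → V} {l : NNReal}

theorem norm_conv_comp_sub_le (h : IsGreenKernel K k η L) (hN : LipschitzWith l N) (hN0 : N 0 = 0)
    {w w' : ℝ → E} (hw : Admissible η w) (hw' : Admissible η w') {D : ℝ} (hD : 0 ≤ D)
    (hd : ∀ s ≤ 0, ‖w s - w' s‖ ≤ D * Real.exp (η * s)) (t : ℝ) :
    ‖conv K (fun s => N (w s)) t - conv K (fun s => N (w' s)) t‖ ≤
      l * L * D * Real.exp (η * t) := by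
  rw [h.conv_sub (hw.comp_lipschitz hN hN0) (hw'.comp_lipschitz hN hN0)]
  refine (h.norm_conv_le (D := l * D) (by positivity) (fun s hs => ?_) t).trans_eq (by ring)
  calc ‖N (w s) - N (w' s)‖ ≤ l * ‖w s - w' s‖ := hN.norm_sub_le _ _
    _ ≤ l * (D * Real.exp (η * s)) := by gcongr; exact hd s hs
    _ = l * D * Real.exp (η * s) := by ring

theorem conv_comp_zero (hN0 : N 0 = 0) (t : ℝ) :
    conv K (fun s => N ((0 : ℝ → E) s)) t = 0 := by
  simp [conv, hN0]

end IsGreenKernel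

end Green

section WeightedLipschitz

theorem le_exp_of_self_improving {d : ℝ → ℝ} {η L R K : ℝ} (hd0 : ∀ t ≤ 0, 0 ≤ d t)
    (hK : ∀ t ≤ 0, d t ≤ K * Real.exp (η * t)) (hL : L < 1)
    (h : ∀ D, 0 ≤ D → (∀ t ≤ 0, d t ≤ D * Real.exp (η * t)) →
      ∀ t ≤ 0, d t ≤ (R + L * D) * Real.exp (η * t)) {t : ℝ} (ht : t ≤ 0) :
    d t ≤ R / (1 - L) * Real.exp (η * t) := by
  set q : ℝ → ℝ := fun t => d t / Real.exp (η * t)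
  have hq_le : ∀ {t D}, q t ≤ D ↔ d t ≤ D * Real.exp (η * t) := div_le_iff₀ (Real.exp_pos _)
  have h_bdd : BddAbove (q '' Iic 0) :=
    ⟨K, forall_mem_image.2 fun s hs => hq_le.2 (hK s hs)⟩
  set D := sSup (q '' Iic 0)
  have hqD : ∀ s ≤ 0, q s ≤ D := fun s hs => le_csSup h_bdd (mem_image_of_mem q hs)
  have hD0 : 0 ≤ D := (div_nonneg (hd0 0 le_rfl) (Real.exp_pos _).le).trans (hqD 0 le_rfl)
  have hD : D ≤ R + L * D := csSup_le (nonempty_Iic.image q) <| forall_mem_image.2 fun s hs =>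
    hq_le.2 (h D hD0 (fun r hr => hq_le.1 (hqD r hr)) s hs)
  refine hq_le.1 ((hqD t ht).trans ?_)
  rw [le_div_iff₀ (by linarith)]
  linarith

variable {E : Type*} [NormedAddCommGroup E]

/-- A map of functions on `(-∞, 0]` with Lipschitz constant `L` in the sup norm with weight
`e^{-ηt}`; the norm is encoded by the bounds `‖w s‖ ≤ D e^{ηs}` because it may be infinite. -/
structure IsWeightedLipschitz (Φ : (ℝ → E) → ℝ → E) (η L : ℝ) : Prop where
  nonneg : 0 ≤ L
  map_zero : ∀ t, Φ 0 t = 0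
  continuousOn : ∀ w, Admissible η w → ContinuousOn (Φ w) (Iic 0)
  lipschitz : ∀ w w', Admissible η w → Admissible η w' → ∀ D, 0 ≤ D →
    (∀ s ≤ 0, ‖w s - w' s‖ ≤ D * Real.exp (η * s)) →
    ∀ t ≤ 0, ‖Φ w t - Φ w' t‖ ≤ L * D * Real.exp (η * t)

open BoundedContinuousFunction

/-- The function `e^{ηs} v(s)` on `(-∞, 0]`, continued past `0`; it identifies bounded continuous
functions with the functions of finite norm in the weighted space. -/
noncomputable def weightedExtend [NormedSpace ℝ E] (η : ℝ) (v : Iic (0 : ℝ) →ᵇ E) (s : ℝ) : E :=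
  Real.exp (η * s) • IicExtend v s

section weightedExtend

variable [NormedSpace ℝ E] {η : ℝ}

theorem norm_weightedExtend_le (v : Iic (0 : ℝ) →ᵇ E) (s : ℝ) :
    ‖weightedExtend η v s‖ ≤ ‖v‖ * Real.exp (η * s) := by
  rw [weightedExtend, norm_smul, Real.norm_eq_abs, Real.abs_exp, mul_comm]
  exact mul_le_mul_of_nonneg_right (v.norm_coe_le_norm _) (Real.exp_pos _).le

theorem weightedExtend_sub (v v' : Iic (0 : ℝ) →ᵇ E) (s : ℝ) :
    weightedExtend η (v - v') s = weightedExtend η v s - weightedExtend η v' s := by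
  simp only [weightedExtend, IicExtend, Function.comp, BoundedContinuousFunction.sub_apply,
    smul_sub]

theorem weightedExtend_of_le (v : Iic (0 : ℝ) →ᵇ E) {s : ℝ} (hs : s ≤ 0) :
    weightedExtend η v s = Real.exp (η * s) • v ⟨s, hs⟩ := by
  rw [weightedExtend, IicExtend_of_mem v hs]

theorem continuous_weightedExtend (v : Iic (0 : ℝ) →ᵇ E) : Continuous (weightedExtend η v) :=
  Continuous.smul (by fun_prop) (v.continuous.comp (Continuous.subtype_mk (by fun_prop) _))

theorem admissible_weightedExtend (v : Iic (0 : ℝ) →ᵇ E) : Admissible η (weightedExtend η v) :=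
  .of_continuousOn (continuous_weightedExtend v).continuousOn fun s _ => norm_weightedExtend_le v s

end weightedExtend

namespace IsWeightedLipschitz

variable {Φ : (ℝ → E) → ℝ → E} {η L R : ℝ} {p : ℝ → E}

theorem norm_sub_le (h : IsWeightedLipschitz Φ η L) (hL : L < 1) {w w' p' : ℝ → E}
    (hw : Admissible η w) (hw' : Admissible η w')
    (hp : ∀ t ≤ 0, w t = p t + Φ w t) (hp' : ∀ t ≤ 0, w' t = p' t + Φ w' t)
    (hR : ∀ t ≤ 0, ‖p t - p' t‖ ≤ R * Real.exp (η * t)) {t : ℝ} (ht : t ≤ 0) :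
    ‖w t - w' t‖ ≤ R / (1 - L) * Real.exp (η * t) := by
  obtain ⟨D, hD⟩ := hw.2
  obtain ⟨D', hD'⟩ := hw'.2
  refine le_exp_of_self_improving (d := fun t => ‖w t - w' t‖) (K := D + D')
    (fun _ _ => norm_nonneg _) (fun s hs => ?_) hL (fun D hD0 hD s hs => ?_) ht
  · rw [add_mul]
    exact (_root_.norm_sub_le _ _).trans (add_le_add (hD s hs) (hD' s hs))
  · rw [hp s hs, hp' s hs, add_sub_add_comm, add_mul]
    exact (norm_add_le _ _).trans
      (add_le_add (hR s hs) (h.lipschitz w w' hw hw' D hD0 hD s hs))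

variable [NormedSpace ℝ E]

theorem norm_add_weightedExtend_le (h : IsWeightedLipschitz Φ η L)
    (hp : ∀ t ≤ 0, ‖p t‖ ≤ R * Real.exp (η * t)) (v : Iic (0 : ℝ) →ᵇ E) {t : ℝ} (ht : t ≤ 0) :
    ‖p t + Φ (weightedExtend η v) t‖ ≤ (R + L * ‖v‖) * Real.exp (η * t) := by
  have h_lip := h.lipschitz _ 0 (admissible_weightedExtend v) .zero ‖v‖ (norm_nonneg _)
    (fun s _ => by simpa only [Pi.zero_apply, sub_zero] using norm_weightedExtend_le v s) t ht
  rw [h.map_zero, sub_zero] at h_lip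
  rw [add_mul]
  exact (norm_add_le _ _).trans (add_le_add (hp t ht) h_lip)

theorem norm_exp_neg_smul_le {x : E} {C t : ℝ} (hx : ‖x‖ ≤ C * Real.exp (η * t)) :
    ‖Real.exp (-(η * t)) • x‖ ≤ C := by
  rw [norm_smul, Real.norm_eq_abs, Real.abs_exp, Real.exp_neg, inv_mul_le_iff₀ (Real.exp_pos _)]
  linarith

/-- The map `w ↦ p + Φ w` on the weighted space, read off on bounded continuous functions. -/
noncomputable def picardMap (h : IsWeightedLipschitz Φ η L) (hpc : ContinuousOn p (Iic 0))
    (hp : ∀ t ≤ 0, ‖p t‖ ≤ R * Real.exp (η * t)) (v : Iic (0 : ℝ) →ᵇ E) : Iic (0 : ℝ) →ᵇ E :=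
  BoundedContinuousFunction.ofNormedAddCommGroup
    (fun s => Real.exp (-(η * s)) • (p s + Φ (weightedExtend η v) s))
    (Continuous.smul (by fun_prop) (continuousOn_iff_continuous_domRestrict.1
      (hpc.add (h.continuousOn _ (admissible_weightedExtend v)))))
    (R + L * ‖v‖) fun s => norm_exp_neg_smul_le (h.norm_add_weightedExtend_le hp v s.2)

theorem contractingWith_picardMap (h : IsWeightedLipschitz Φ η L) (hL : L < 1)
    (hpc : ContinuousOn p (Iic 0)) (hp : ∀ t ≤ 0, ‖p t‖ ≤ R * Real.exp (η * t)) :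
    ContractingWith L.toNNReal (h.picardMap hpc hp) := by
  refine ⟨by rwa [← NNReal.coe_lt_coe, Real.coe_toNNReal _ h.nonneg],
    LipschitzWith.of_dist_le_mul fun v v' => ?_⟩
  rw [Real.coe_toNNReal _ h.nonneg,
    BoundedContinuousFunction.dist_le (mul_nonneg h.nonneg dist_nonneg)]
  rintro ⟨s, hs⟩
  simp only [dist_eq_norm, picardMap, BoundedContinuousFunction.coe_ofNormedAddCommGroup]
  rw [← smul_sub, add_sub_add_left_eq_sub]
  refine norm_exp_neg_smul_le (h.lipschitz _ _ (admissible_weightedExtend v)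
    (admissible_weightedExtend v') ‖v - v'‖ (norm_nonneg _) (fun r _ => ?_) s hs)
  rw [← weightedExtend_sub]
  exact norm_weightedExtend_le _ r

theorem exists_solution [CompleteSpace E] (h : IsWeightedLipschitz Φ η L) (hL : L < 1)
    (hpc : ContinuousOn p (Iic 0)) (hp : ∀ t ≤ 0, ‖p t‖ ≤ R * Real.exp (η * t)) :
    ∃ w : ℝ → E, ContinuousOn w (Iic 0) ∧ (∃ D, ∀ t ≤ 0, ‖w t‖ ≤ D * Real.exp (η * t)) ∧
      ∀ t ≤ 0, w t = p t + Φ w t := by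
  have h_contr := h.contractingWith_picardMap hL hpc hp
  set v := h_contr.fixedPoint
  refine ⟨weightedExtend η v, (continuous_weightedExtend v).continuousOn,
    ⟨‖v‖, fun t _ => norm_weightedExtend_le v t⟩, fun t ht => ?_⟩
  have hv : v ⟨t, ht⟩ = Real.exp (-(η * t)) • (p t + Φ (weightedExtend η v) t) :=
    (DFunLike.congr_fun h_contr.fixedPoint_isFixedPt ⟨t, ht⟩).symm
  rw [weightedExtend_of_le v ht, hv, smul_smul, ← Real.exp_add, add_neg_cancel, Real.exp_zero,
    one_smul]

end IsWeightedLipschitz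

end WeightedLipschitz

section Kernels

variable {V W Z : Type*} [NormedAddCommGroup V] [NormedSpace ℝ V]
  [NormedAddCommGroup W] [NormedSpace ℝ W] [NormedAddCommGroup Z] [NormedSpace ℝ Z]

theorem integrableOn_of_setIntegral_pos {f : ℝ → ℝ} {s : Set ℝ} (h : 0 < ∫ r in s, f r) :
    IntegrableOn f s :=
  Integrable.of_integral_ne_zero h.ne'

theorem continuousOn_indicator_compl_frontier {α F : Type*} [TopologicalSpace α]
    [TopologicalSpace F] [Zero F] {s : Set α} {f : α → F} (hf : ContinuousOn f s) :
    ContinuousOn (s.indicator f) (frontier s)ᶜ := fun _ hx =>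
  ((hf.mono interior_subset).continuousAt_indicator hx).continuousWithinAt

namespace IsGreenKernel

variable {T : ℝ → V →L[ℝ] W} {C β η L : ℝ}

theorem indicator {k : ℝ → ℝ} {s : Set ℝ} (hs : IsOpen s) (hs0 : frontier s = {0})
    (hT : ∀ v, ContinuousOn (fun r => T r v) s) (hk : ContinuousOn k s)
    (hTk : ∀ r ∈ s, ‖T r‖ ≤ k r) (hi : IntegrableOn (fun r => k r * Real.exp (-η * r)) s)
    (hL : ∫ r in s, k r * Real.exp (-η * r) ≤ L) :
    IsGreenKernel (s.indicator T) (s.indicator k) η L := by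
  have h_mul : (fun r => s.indicator k r * Real.exp (-η * r)) =
      s.indicator fun r => k r * Real.exp (-η * r) := by
    ext r
    by_cases hr : r ∈ s <;> simp [hr]
  refine ⟨fun v => ?_, hs0 ▸ continuousOn_indicator_compl_frontier hk, fun r => ?_, ?_, ?_⟩
  · refine (hs0 ▸ continuousOn_indicator_compl_frontier (hT v)).congr fun r _ => ?_
    by_cases hr : r ∈ s <;> simp [hr]
  · by_cases hr : r ∈ s
    · simpa only [indicator_of_mem hr] using hTk r hr
    · simp only [indicator_of_notMem hr, norm_zero, le_refl]
  · rw [h_mul]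
    exact (integrable_indicator_iff hs.measurableSet).2 hi
  · rw [h_mul, integral_indicator hs.measurableSet]
    exact hL

theorem forward {a : ℝ} (ha : 0 < a) (hβ : β < η) (hT : ∀ v, ContinuousOn (fun r => T r v) (Ioi 0))
    (hTC : ∀ r, 0 < r → ‖T r‖ ≤ C * r ^ (a - 1) * Real.exp (β * r)) :
    IsGreenKernel ((Ioi 0).indicator T)
      ((Ioi 0).indicator fun r => C * r ^ (a - 1) * Real.exp (β * r)) η
      (C * Real.Gamma a / (η - β) ^ a) := by
  have hηβ : 0 < η - β := sub_pos.2 hβ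
  have h_gamma := Real.integral_rpow_mul_exp_neg_mul_Ioi ha hηβ
  have h_pos := mul_pos (Real.rpow_pos_of_pos (one_div_pos.2 hηβ) a) (Real.Gamma_pos_of_pos ha)
  have h_eq (r : ℝ) : C * r ^ (a - 1) * Real.exp (β * r) * Real.exp (-η * r) =
      C * (r ^ (a - 1) * Real.exp (-((η - β) * r))) := by
    have h_exp : Real.exp (-((η - β) * r)) = Real.exp (β * r) * Real.exp (-η * r) := by
      rw [← Real.exp_add]; ring_nf
    rw [h_exp]
    ring
  refine .indicator isOpen_Ioi frontier_Ioi hT ?_ hTC ?_ ?_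
  · exact (continuousOn_const.mul (continuousOn_id.rpow_const fun r hr =>
      Or.inl (ne_of_gt hr))).mul (by fun_prop)
  · simp_rw [h_eq]
    exact (integrableOn_of_setIntegral_pos (h_gamma ▸ h_pos)).const_mul C
  · simp_rw [h_eq]
    rw [integral_const_mul, h_gamma, Real.div_rpow zero_le_one hηβ.le, Real.one_rpow]
    exact le_of_eq (by ring)

theorem backward (hβ : η < β) (hT : ∀ v, ContinuousOn (fun r => T r v) (Iio 0))
    (hTC : ∀ r, r < 0 → ‖T r‖ ≤ C * Real.exp (β * r)) :
    IsGreenKernel ((Iio 0).indicator T) ((Iio 0).indicator fun r => C * Real.exp (β * r)) η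
      (C / (β - η)) := by
  have hβη : 0 < β - η := sub_pos.2 hβ
  have h_integral : ∫ r in Iio (0 : ℝ), Real.exp ((β - η) * r) = 1 / (β - η) := by
    rw [← integral_Iic_eq_integral_Iio, integral_exp_mul_Iic hβη, mul_zero, Real.exp_zero]
  have h_eq (r : ℝ) : C * Real.exp (β * r) * Real.exp (-η * r) =
      C * Real.exp ((β - η) * r) := by
    rw [mul_assoc, ← Real.exp_add]; ring_nf
  refine .indicator isOpen_Iio frontier_Iio hT (by fun_prop) hTC ?_ ?_
  · simp_rw [h_eq]
    exact (integrableOn_of_setIntegral_pos (h_integral ▸ one_div_pos.2 hβη)).const_mul C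
  · simp_rw [h_eq]
    rw [integral_const_mul, h_integral, mul_one_div]

variable {K : ℝ → V →L[ℝ] W} {k : ℝ → ℝ} {φ : ℝ → V} {j : W →L[ℝ] Z} {F : ℝ → V → Z} {t : ℝ}

theorem integrableOn_forward (h : IsGreenKernel K k η L) (hφ : Admissible η φ)
    (hj : ∀ r v, j (K r v) = (Ioi 0).indicator (fun r => F r v) r) (ht : t ≤ 0) :
    IntegrableOn (fun s => F (t - s) (φ s)) (Iic t) := by
  have h_int : IntegrableOn (fun s => j (K (t - s) (φ s))) (Iic 0) :=
    j.integrable_comp (h.integrableOn hφ t)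
  rw [integrableOn_Iic_iff_integrableOn_Iio]
  refine (h_int.mono_set (Iio_subset_Iic_iff.2 ht)).congr_fun
    (fun s (hs : s < t) => ?_) measurableSet_Iio
  simp [hj, hs]

theorem integrableOn_backward (h : IsGreenKernel K k η L) (hφ : Admissible η φ)
    (hj : ∀ r v, j (K r v) = -(Iio 0).indicator (fun r => F r v) r) (t : ℝ) :
    IntegrableOn (fun s => F (t - s) (φ s)) (Ioc t 0) := by
  have h_int : IntegrableOn (fun s => -j (K (t - s) (φ s))) (Iic 0) :=
    (j.integrable_comp (h.integrableOn hφ t)).neg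
  refine (h_int.mono_set fun s hs => hs.2).congr_fun (fun s hs => ?_) measurableSet_Ioc
  simp [hj, hs.1]

variable [CompleteSpace W] [CompleteSpace Z]

theorem map_conv_forward (h : IsGreenKernel K k η L) (hφ : Admissible η φ)
    (hj : ∀ r v, j (K r v) = (Ioi 0).indicator (fun r => F r v) r) (ht : t ≤ 0) :
    j (conv K φ t) = ∫ s in Iic t, F (t - s) (φ s) := by
  have h_eq : (fun s => j (K (t - s) (φ s))) = (Iio t).indicator fun s => F (t - s) (φ s) := by
    ext s
    by_cases hs : s < t <;> simp [hj, hs]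
  rw [h.map_conv hφ, h_eq, setIntegral_indicator measurableSet_Iio,
    inter_eq_right.2 (Iio_subset_Iic_iff.2 ht),
    integral_Iic_eq_integral_Iio]

theorem map_conv_backward (h : IsGreenKernel K k η L) (hφ : Admissible η φ)
    (hj : ∀ r v, j (K r v) = -(Iio 0).indicator (fun r => F r v) r) (ht : t ≤ 0) :
    j (conv K φ t) = ∫ s in (0 : ℝ)..t, F (t - s) (φ s) := by
  have h_eq : (fun s => j (K (t - s) (φ s))) = (Ioi t).indicator fun s => -F (t - s) (φ s) := by
    ext s
    by_cases hs : t < s <;> simp [hj, hs]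
  rw [h.map_conv hφ, h_eq, setIntegral_indicator measurableSet_Ioi, Iic_inter_Ioi,
    intervalIntegral.integral_of_ge ht, integral_neg]

theorem map_conv_eq_zero (h : IsGreenKernel K k η L) (hφ : Admissible η φ)
    (hj : ∀ r v, j (K r v) = 0) (t : ℝ) : j (conv K φ t) = 0 := by
  simp only [h.map_conv hφ, hj, integral_zero]

end IsGreenKernel

theorem exists_lift {j : W →L[ℝ] Z} (hj : Function.Injective j) {s : Set ℝ} (F : ℝ → V →L[ℝ] Z)
    {b : ℝ → ℝ} (hb : ∀ t ∈ s, 0 ≤ b t)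
    (h : ∀ t ∈ s, ∀ v, ∃ w, j w = F t v ∧ ‖w‖ ≤ b t * ‖v‖) :
    ∃ G : ℝ → V →L[ℝ] W, ∀ t ∈ s, (∀ v, j (G t v) = F t v) ∧ ‖G t‖ ≤ b t := by
  choose! G hG hGb using h
  let lift (t : ℝ) (ht : t ∈ s) : V →L[ℝ] W := LinearMap.mkContinuous
    { toFun := G t
      map_add' := fun x y => hj (by simp only [hG t ht, map_add])
      map_smul' := fun c x => hj (by simp only [hG t ht, map_smul, RingHom.id_apply]) }
    (b t) (hGb t ht)
  classical
  refine ⟨fun t => if ht : t ∈ s then lift t ht else 0, fun t ht => ?_⟩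
  simp only [dif_pos ht]
  exact ⟨hG t ht, LinearMap.mkContinuous_norm_le _ (hb t ht) _⟩

theorem IsGenerator.exists_smoothing {X X₁ : Type*} [NormedAddCommGroup X] [NormedSpace ℝ X]
    [NormedAddCommGroup X₁] [NormedSpace ℝ X₁] [CompleteSpace X] [CompleteSpace X₁]
    {S : C0Semigroup X} {ι A : X₁ →L[ℝ] X} (h : IsGenerator S ι A) (i : V →L[ℝ] X) {b : ℝ → ℝ}
    (hb0 : ∀ t, 0 < t → 0 ≤ b t)
    (hb : ∀ t, 0 < t → ∀ v, ∃ z : X₁, ι z = S.op t (i v) ∧ ‖z‖ ≤ b t * ‖v‖) :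
    ∃ T : ℝ → V →L[ℝ] X₁, (∀ t, 0 < t → ∀ v, ι (T t v) = S.op t (i v)) ∧
      (∀ t, 0 < t → ‖T t‖ ≤ b t) ∧ ∀ v, ContinuousOn (fun t => T t v) (Ioi 0) := by
  obtain ⟨T, hT⟩ := exists_lift (s := Ioi 0) h.1 (fun t => (S.op t).comp i) hb0 hb
  refine ⟨T, fun t ht => (hT t ht).1, fun t ht => (hT t ht).2, fun v t (ht : 0 < t) => ?_⟩
  have h_half : 0 < t / 2 := half_pos ht
  have h_nhds : Ioi (t / 2) ∈ 𝓝 t := Ioi_mem_nhds (half_lt_self ht)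
  have h_cont : ContinuousOn (fun s => h.domainOp (s - t / 2) (T (t / 2) v)) (Ioi (t / 2)) :=
    (h.continuousOn_domainOp _).comp (f := fun s => s - t / 2) (by fun_prop)
      fun s (hs : t / 2 < s) => (sub_pos.2 hs).le
  refine ((h_cont.continuousAt h_nhds).congr ?_).continuousWithinAt
  filter_upwards [h_nhds] with s (hs : t / 2 < s)
  refine h.1 ?_
  rw [h.ι_domainOp (sub_pos.2 hs).le, (hT _ h_half).1, (hT s (h_half.trans hs)).1,
    ContinuousLinearMap.comp_apply, ContinuousLinearMap.comp_apply,
    ← S.op_add_apply (sub_pos.2 hs).le h_half.le, sub_add_cancel]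

theorem one_le_Gamma_of_mem_Ioc {a : ℝ} (ha : a ∈ Ioc (0 : ℝ) 1) : 1 ≤ Real.Gamma a := by
  rcases ha.2.eq_or_lt with rfl | ha1
  · rw [Real.Gamma_one]
  · have h_slope := Real.convexOn_Gamma.slope_mono_adjacent (x := a) (y := 1) (z := 2) ha.1
      (by norm_num : (2 : ℝ) ∈ Ioi 0) ha1 one_lt_two
    rw [Real.Gamma_one, Real.Gamma_two, sub_self, zero_div, div_le_iff₀ (by linarith)] at h_slope
    linarith

end Kernels

theorem C0Group.continuous_orbit {X : Type*} [NormedAddCommGroup X] [NormedSpace ℝ X]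
    (G : C0Group X) (x : X) : Continuous fun t => G.op t x := by
  rw [continuous_iff_continuousAt]
  intro t
  have h_shift : Tendsto (fun s : ℝ => s - t) (𝓝 t) (𝓝 0) := by
    simpa using (continuous_sub_right t).tendsto t
  refine (((G.op t).continuous.tendsto x).comp
    ((G.strongly_continuous x).comp h_shift)).congr fun s => ?_
  change (G.op t).comp (G.op (s - t)) x = _
  rw [← G.op_add, add_sub_cancel]

theorem nonpos_of_one_le_mul_exp {b c : ℝ} (h : ∀ t, 0 ≤ t → 1 ≤ c * Real.exp (-(b * t))) :
    b ≤ 0 := by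
  by_contra! hb
  have h_lim : Tendsto (fun t : ℝ => c * Real.exp (-(b * t))) atTop (𝓝 0) := by
    simpa using (Real.tendsto_exp_neg_atTop_nhds_zero.comp
      (tendsto_id.const_mul_atTop hb)).const_mul c
  exact not_lt.2 (ge_of_tendsto h_lim (eventually_atTop.2 ⟨0, h⟩)) one_pos

section Splitting

variable {Y Y₁ Yδ : Type*} [NormedAddCommGroup Y] [NormedSpace ℝ Y]
  [NormedAddCommGroup Y₁] [NormedSpace ℝ Y₁] [NormedAddCommGroup Yδ] [NormedSpace ℝ Yδ]
  {sp : Scale Y Y₁ Yδ}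

theorem Scale.isInducing_gen (sp : Scale Y Y₁ Yδ) : IsInducing sp.gen :=
  (AddMonoidHomClass.isometry_of_norm sp.gen sp.norm_gen).isUniformInducing.isInducing

namespace Splitting

variable {δ βF βS CB MB : ℝ} (D : Splitting sp δ βF βS CB MB)

theorem P_of_mem_range {y : Y} (hy : y ∈ D.P.range) : D.P y = y := by
  obtain ⟨x, rfl⟩ := hy
  exact D.P_idem x

theorem isSlow_iff {y : Y₁} : D.IsSlow y ↔ D.P (sp.ι₁ y) = sp.ι₁ y :=
  ⟨D.P_of_mem_range, fun h => ⟨_, h⟩⟩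

theorem P_slowFlow (t : ℝ) (y : Y) : D.P (D.slowFlow t y) = D.slowFlow t y :=
  D.P_of_mem_range (D.group.op t _).2

theorem slowFlow_P (t : ℝ) (y : Y) : D.slowFlow t (D.P y) = D.slowFlow t y := by
  simp only [slowFlow, D.P_idem]

theorem slowFlow_zero (y : Y) : D.slowFlow 0 y = D.P y := by
  simp only [slowFlow, D.group.op_zero, ContinuousLinearMap.id_apply]

theorem slowFlow_add (s t : ℝ) (y : Y) :
    D.slowFlow (s + t) y = D.slowFlow s (D.slowFlow t y) := by
  have h_proj : (⟨D.P (D.slowFlow t y), D.slowFlow t y, rfl⟩ : D.P.range) =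
      D.group.op t ⟨D.P y, y, rfl⟩ := Subtype.ext (D.P_slowFlow t y)
  rw [slowFlow, slowFlow, h_proj, D.group.op_add]
  rfl

theorem slowFlow_of_nonneg {t : ℝ} (ht : 0 ≤ t) (y : Y) :
    D.slowFlow t y = sp.semigroup.op t (D.P y) :=
  D.group_eq t ht _

/-- The slow flow at a fixed time, as a bounded operator on `Y`. -/
noncomputable def slowFlowCLM (t : ℝ) : Y →L[ℝ] Y :=
  D.P.range.subtypeL.comp ((D.group.op t).comp D.P.rangeRestrict)

theorem slowFlowCLM_apply (t : ℝ) (y : Y) : D.slowFlowCLM t y = D.slowFlow t y := rfl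

theorem continuous_slowFlow (y : Y) : Continuous fun t => D.slowFlow t y :=
  continuous_subtype_val.comp (D.group.continuous_orbit _)

theorem P_gen_of_isSlow {y : Y₁} (hy : D.IsSlow y) : D.P (sp.gen y) = sp.gen y := by
  obtain ⟨y', hιy', hAy'⟩ := D.P_comm y
  rw [D.isSlow_iff.1 hy] at hιy'
  rw [← hAy', sp.isGenerator.1 hιy']

theorem isSlow_of_ι₁_eq_slowFlow {t : ℝ} {y : Y} {z : Y₁} (h : sp.ι₁ z = D.slowFlow t y) :
    D.IsSlow z :=
  D.isSlow_iff.2 (by rw [h, D.P_slowFlow])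

theorem gen_of_ι₁_eq_slowFlow {t : ℝ} (ht : t ≤ 0) {y z : Y₁} (hy : D.IsSlow y)
    (h : sp.ι₁ z = D.slowFlow t (sp.ι₁ y)) : sp.gen z = D.slowFlow t (sp.gen y) := by
  have hz : D.IsSlow z := D.isSlow_of_ι₁_eq_slowFlow h
  obtain ⟨x, hιx, hAx⟩ := sp.isGenerator.exists_op (neg_nonneg.2 ht) z
  rw [← D.isSlow_iff.1 hz, ← D.slowFlow_of_nonneg (neg_nonneg.2 ht), h, ← D.slowFlow_add,
    neg_add_cancel, D.slowFlow_zero, D.isSlow_iff.1 hy] at hιx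
  rw [sp.isGenerator.1 hιx, ← D.P_gen_of_isSlow hz,
    ← D.slowFlow_of_nonneg (neg_nonneg.2 ht)] at hAx
  rw [hAx, ← D.slowFlow_add, add_neg_cancel, D.slowFlow_zero, D.P_gen_of_isSlow hz]

theorem exists_slow_backward {y : Y₁} (hy : D.IsSlow y) {t : ℝ} (ht : t ≤ 0) :
    ∃ z : Y₁, sp.ι₁ z = D.slowFlow t (sp.ι₁ y) ∧ ‖z‖ ≤ MB * Real.exp (βS * t) * ‖y‖ := by
  obtain ⟨z, hιz, hz⟩ := D.bound_slow (-t) (neg_nonneg.2 ht) y hy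
  have h_proj : (⟨D.P (sp.ι₁ y), sp.ι₁ y, rfl⟩ : D.P.range) = ⟨sp.ι₁ y, hy⟩ :=
    Subtype.ext (D.isSlow_iff.1 hy)
  exact ⟨z, by rw [hιz, neg_neg, slowFlow, h_proj], by simpa using hz⟩

theorem exists_slow_orbit {y : Y₁} (hy : D.IsSlow y) :
    ∃ q : ℝ → Y₁, ContinuousOn q (Iic 0) ∧ ∀ t ≤ 0,
      sp.ι₁ (q t) = D.slowFlow t (sp.ι₁ y) ∧ ‖q t‖ ≤ MB * Real.exp (βS * t) * ‖y‖ := by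
  choose! q hq using fun t (ht : t ≤ 0) => D.exists_slow_backward hy ht
  refine ⟨q, ?_, hq⟩
  rw [sp.isInducing_gen.continuousOn_iff]
  exact (D.continuous_slowFlow (sp.gen y)).continuousOn.congr fun t ht =>
    D.gen_of_ι₁_eq_slowFlow ht hy (hq t ht).1

theorem isSlow_Q (y : Yδ) : D.IsSlow (D.Q y) := ⟨_, (D.ι₁_Q y).symm⟩

theorem slowFlow_ι₁_Q (t : ℝ) (y : Yδ) :
    D.slowFlow t (sp.ι₁ (D.Q y)) = D.slowFlow t (sp.ι y) := by
  rw [D.ι₁_Q, D.slowFlow_P]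

theorem exists_slow_smoothing (hMB : 0 ≤ MB) :
    ∃ T : ℝ → Yδ →L[ℝ] Y₁, (∀ t, t < 0 → ∀ y, sp.ι₁ (T t y) = D.slowFlow t (sp.ι y)) ∧
      (∀ t, t < 0 → ‖T t‖ ≤ MB * ‖D.Q‖ * Real.exp (βS * t)) ∧
      ∀ y, ContinuousOn (fun t => T t y) (Iio 0) := by
  have h_lift : ∀ t ∈ Iio (0 : ℝ), ∀ y, ∃ z, sp.ι₁ z = ((D.slowFlowCLM t).comp sp.ι) y ∧
      ‖z‖ ≤ MB * ‖D.Q‖ * Real.exp (βS * t) * ‖y‖ := by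
    intro t ht y
    obtain ⟨z, hιz, hz⟩ := D.exists_slow_backward (D.isSlow_Q y) (le_of_lt ht)
    refine ⟨z, hιz.trans (D.slowFlow_ι₁_Q t y), hz.trans ?_⟩
    calc MB * Real.exp (βS * t) * ‖D.Q y‖ ≤ MB * Real.exp (βS * t) * (‖D.Q‖ * ‖y‖) := by
          gcongr; exact D.Q.le_opNorm y
      _ = MB * ‖D.Q‖ * Real.exp (βS * t) * ‖y‖ := by ring
  obtain ⟨T, hT⟩ := exists_lift sp.isGenerator.1 _ (fun t _ => by positivity) h_lift
  refine ⟨T, fun t ht => (hT t ht).1, fun t ht => (hT t ht).2, fun y => ?_⟩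
  rw [sp.isInducing_gen.continuousOn_iff]
  refine (D.continuous_slowFlow (sp.gen (D.Q y))).continuousOn.congr fun t ht => ?_
  exact D.gen_of_ι₁_eq_slowFlow (le_of_lt ht) (D.isSlow_Q y)
    (((hT t ht).1 y).trans (D.slowFlow_ι₁_Q t y).symm)

/-- Going forward along the decaying semigroup and back along the group returns to `y`. -/
theorem one_le_of_isSlow (hMB : 0 ≤ MB) {M ω : ℝ}
    (hM : ∀ t, 0 ≤ t → ‖sp.semigroup.op t‖ ≤ M * Real.exp (-ω * t)) {y : Y₁} (hy : D.IsSlow y)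
    (hy0 : y ≠ 0) {t : ℝ} (ht : 0 ≤ t) : 1 ≤ MB * M * Real.exp (-((βS + ω) * t)) := by
  obtain ⟨z, hιz, hAz⟩ := sp.isGenerator.exists_op ht y
  have hιz_flow : sp.ι₁ z = D.slowFlow t (sp.ι₁ y) := by
    rw [hιz, D.slowFlow_of_nonneg ht, D.isSlow_iff.1 hy]
  obtain ⟨x, hιx, hx⟩ :=
    D.exists_slow_backward (D.isSlow_of_ι₁_eq_slowFlow hιz_flow) (neg_nonpos.2 ht)
  rw [hιz_flow, ← D.slowFlow_add, neg_add_cancel, D.slowFlow_zero, D.isSlow_iff.1 hy] at hιx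
  rw [sp.isGenerator.1 hιx] at hx
  have hz : ‖z‖ ≤ M * Real.exp (-ω * t) * ‖y‖ := by
    rw [← sp.norm_gen z, hAz, ← sp.norm_gen y]
    exact (sp.semigroup.op t).le_of_opNorm_le (hM t ht) _
  refine le_of_mul_le_mul_right ?_ (norm_pos_iff.2 hy0)
  calc 1 * ‖y‖ = ‖y‖ := one_mul _
    _ ≤ MB * Real.exp (βS * -t) * (M * Real.exp (-ω * t) * ‖y‖) := hx.trans (by gcongr)
    _ = MB * M * (Real.exp (βS * -t) * Real.exp (-ω * t)) * ‖y‖ := by ring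
    _ = MB * M * Real.exp (-((βS + ω) * t)) * ‖y‖ := by rw [← Real.exp_add]; ring_nf

theorem P_ι_prF (y : Yδ) : D.P (sp.ι (D.prF y)) = 0 := by
  simp [prF, sp.ι_κ, D.ι₁_Q, D.P_idem]

theorem exists_fast_bound (hδ : δ ≤ 1) (hCB : 0 ≤ CB) {η : ℝ} (hη : βF ≤ η) (hη0 : η ≤ 0) :
    ∃ c, 0 ≤ c ∧ ∀ y, D.IsFast y → ∀ t, 0 ≤ t →
      ‖sp.isGenerator.domainOp t y‖ ≤ c * Real.exp (η * t) * ‖y‖ := by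
  obtain ⟨M, ω, hω, hM⟩ := sp.exp_stable
  have hM0 : 0 ≤ M := by simpa using (norm_nonneg _).trans (hM 0 le_rfl)
  refine ⟨M * Real.exp (-η) + CB * ‖sp.κ‖, by positivity, fun y hy t ht => ?_⟩
  rw [add_mul, add_mul]
  rcases le_total t 1 with ht1 | ht1
  · refine le_add_of_le_of_nonneg ?_ (by positivity)
    rw [← sp.norm_gen, sp.isGenerator.A_domainOp ht, ← sp.norm_gen y]
    refine ((sp.semigroup.op t).le_of_opNorm_le (hM t ht) _).trans ?_
    rw [mul_assoc M (Real.exp (-η)), ← Real.exp_add]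
    gcongr
    nlinarith
  · refine le_add_of_nonneg_of_le (by positivity) ?_
    obtain ⟨z, hιz, hz⟩ := D.bound_fast t (by linarith) (sp.κ y) (by rw [sp.ι_κ]; exact hy)
    have h_eq : sp.isGenerator.domainOp t y = z :=
      sp.isGenerator.1 (by rw [sp.isGenerator.ι_domainOp ht, hιz, sp.ι_κ])
    have h_pow : t ^ (δ - 1) ≤ 1 := Real.rpow_le_one_of_one_le_of_nonpos ht1 (by linarith)
    rw [h_eq]
    calc ‖z‖ ≤ CB * t ^ (δ - 1) * Real.exp (βF * t) * ‖sp.κ y‖ := hz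
      _ ≤ CB * 1 * Real.exp (η * t) * (‖sp.κ‖ * ‖y‖) := by
          gcongr
          exact sp.κ.le_opNorm y
      _ = CB * ‖sp.κ‖ * Real.exp (η * t) * ‖y‖ := by ring

variable [CompleteSpace Y]

theorem exists_isSlow_ne_zero (hP : D.P ≠ 0) : ∃ y : Y₁, D.IsSlow y ∧ y ≠ 0 := by
  obtain ⟨x, hx⟩ : ∃ x : Y₁, D.P (sp.ι₁ x) ≠ 0 := by
    by_contra! h
    exact hP (ContinuousLinearMap.coeFn_injective
      (sp.isGenerator.denseRange.equalizer D.P.continuous continuous_const (funext h)))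
  obtain ⟨y, hιy, -⟩ := D.P_comm x
  exact ⟨y, ⟨_, hιy.symm⟩, fun h0 => hx (by rw [← hιy, h0, map_zero])⟩

theorem slowRate_neg (hP : D.P ≠ 0) (hMB : 0 ≤ MB) : βS < 0 := by
  obtain ⟨M, ω, hω, hM⟩ := sp.exp_stable
  obtain ⟨y, hy, hy0⟩ := D.exists_isSlow_ne_zero hP
  linarith [nonpos_of_one_le_mul_exp fun t ht => D.one_le_of_isSlow hMB hM hy hy0 ht]

theorem P_op {t : ℝ} (ht : 0 ≤ t) (y : Y) :
    D.P (sp.semigroup.op t y) = sp.semigroup.op t (D.P y) := by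
  have h := sp.isGenerator
  suffices h_dom : ∀ z : Y₁,
      D.P (sp.semigroup.op t (sp.ι₁ z)) = sp.semigroup.op t (D.P (sp.ι₁ z)) from
    congrFun (h.denseRange.equalizer (g := fun y => D.P (sp.semigroup.op t y))
      (h := fun y => sp.semigroup.op t (D.P y)) (by fun_prop) (by fun_prop) (funext h_dom)) y
  intro z
  -- `s ↦ P e^{sB} z` solves the homogeneous equation with initial value `P z`
  choose p hιp hAp using D.P_comm
  have h_mild := h.variation_of_constants (T := t) (y := fun s => p (h.domainOp s z))
    (φ := fun _ => 0) continuousOn_const (fun s hs => ?_) (right_mem_Icc.2 ht)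
  · simpa [hιp, h.ι_domainOp ht, h.domainOp_zero] using h_mild
  · have h_orbit : HasDerivWithinAt (fun r => sp.semigroup.op r (sp.ι₁ z))
        (sp.semigroup.op s (sp.gen z)) (Icc 0 t) s := by
      rcases hs.1.eq_or_lt with rfl | hs0
      · exact (h.hasDerivWithinAt_orbit le_rfl z).Ici_of_Ioi.mono Icc_subset_Ici_self
      · exact (h.hasDerivAt_orbit hs0 z).hasDerivWithinAt
    rw [add_zero, hAp, h.A_domainOp hs.1]
    refine (D.P.hasFDerivAt.comp_hasDerivWithinAt s h_orbit).congr_of_mem (fun r hr => ?_) hs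
    rw [hιp, h.ι_domainOp hr.1, Function.comp]

end Splitting

end Splitting

/-- The state space `X₁ × Y₁ × Y₁` of the triples `(u, v_F, v_S)`, normed by the sum of the three
norms, to which the Lipschitz constants and the spectral gap condition refer. -/
abbrev SumState (X₁ Y₁ : Type*) : Type _ :=
  WithLp 1 (X₁ × WithLp 1 (Y₁ × Y₁))

namespace SumState

variable {X₁ Y₁ : Type*} [NormedAddCommGroup X₁] [NormedAddCommGroup Y₁]
  [NormedSpace ℝ X₁] [NormedSpace ℝ Y₁]

/-- Triples as elements of `SumState`. -/
noncomputable def equiv : (X₁ × Y₁ × Y₁) ≃L[ℝ] SumState X₁ Y₁ :=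
  ((ContinuousLinearEquiv.refl ℝ X₁).prodCongr
    (WithLp.prodContinuousLinearEquiv 1 ℝ Y₁ Y₁).symm).trans
    (WithLp.prodContinuousLinearEquiv 1 ℝ X₁ (WithLp 1 (Y₁ × Y₁))).symm

theorem norm_equiv (p : X₁ × Y₁ × Y₁) : ‖equiv p‖ = ‖p.1‖ + ‖p.2.1‖ + ‖p.2.2‖ := by
  rw [WithLp.prod_norm_eq_of_L1, WithLp.prod_norm_eq_of_L1, add_assoc]
  rfl

end SumState

section System

variable {X X₁ Xγ Y Y₁ Yδ : Type*}
  [NormedAddCommGroup X] [NormedSpace ℝ X] [NormedAddCommGroup X₁] [NormedSpace ℝ X₁]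
  [NormedAddCommGroup Xγ] [NormedSpace ℝ Xγ]
  [NormedAddCommGroup Y] [NormedSpace ℝ Y] [NormedAddCommGroup Y₁] [NormedSpace ℝ Y₁]
  [NormedAddCommGroup Yδ] [NormedSpace ℝ Yδ] {V : Type*}

/-- A map of `(u, v)`, as a function of the state `(u, v_F, v_S)` with `v = v_F + v_S`. -/
noncomputable def onState (φ : X₁ × Y₁ → V) (x : SumState X₁ Y₁) : V :=
  φ ((SumState.equiv.symm x).1, (SumState.equiv.symm x).2.1 + (SumState.equiv.symm x).2.2)

theorem onState_equiv (φ : X₁ × Y₁ → V) (p : X₁ × Y₁ × Y₁) :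
    onState φ (SumState.equiv p) = φ (p.1, p.2.1 + p.2.2) := by
  rw [onState, ContinuousLinearEquiv.symm_apply_apply]

theorem onState_zero (φ : X₁ × Y₁ → V) : onState φ 0 = φ (0, 0) := by
  simp [onState]

theorem lipschitzWith_onState [NormedAddCommGroup V] {φ : X₁ × Y₁ → V} {l : NNReal}
    (h : ∀ x₁ x₂ y₁ y₂, ‖φ (x₁, y₁) - φ (x₂, y₂)‖ ≤ l * (‖x₁ - x₂‖ + ‖y₁ - y₂‖)) :
    LipschitzWith l (onState φ) := by
  refine LipschitzWith.of_dist_le_mul fun x x' => ?_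
  obtain ⟨p, rfl⟩ := SumState.equiv.surjective x
  obtain ⟨p', rfl⟩ := SumState.equiv.surjective x'
  rw [dist_eq_norm, dist_eq_norm, onState_equiv, onState_equiv, ← map_sub, SumState.norm_equiv]
  refine (h _ _ _ _).trans (mul_le_mul_of_nonneg_left ?_ l.2)
  rw [add_assoc, add_sub_add_comm]
  exact add_le_add_right (norm_add_le _ _) _

theorem System.fMod_zero (S : System X X₁ Xγ Y Y₁ Yδ) : S.fMod (0, 0) = 0 := by
  simp [System.fMod, S.f_zero]

/-- The semigroup generated by `ε⁻¹ Ã_ε`. -/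
noncomputable def ModifiedSemigroup.scaled {S : System X X₁ Xγ Y Y₁ Yδ} {ε γ μ M C : ℝ}
    (E : ModifiedSemigroup S ε γ μ M C) (hε : 0 < ε) : C0Semigroup X :=
  E.semigroup.rescale ε⁻¹ (inv_pos.2 hε)

theorem ModifiedSemigroup.isGenerator_scaled {S : System X X₁ Xγ Y Y₁ Yδ} {ε γ μ M C : ℝ}
    (E : ModifiedSemigroup S ε γ μ M C) (hε : 0 < ε) :
    IsGenerator (E.scaled hε) S.spX.ι₁ (ε⁻¹ • S.genMod ε) :=
  E.isGenerator.rescale (inv_pos.2 hε)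

/-- The integral kernels of the three components of the Lyapunov–Perron operator. They take values
in the domains `X₁` and `Y₁`, and `LX`, `LF`, `LS` bound the norms of the convolutions. The kernel
of `v_S` lives on negative times, since its integral runs from `0` backwards to `t`. -/
structure LyapunovPerronKernels (S : System X X₁ Xγ Y Y₁ Yδ) {ε γ μ M C : ℝ} (hε : 0 < ε)
    (E : ModifiedSemigroup S ε γ μ M C) {δ βF βS CB MB : ℝ}
    (D : Splitting S.spY δ βF βS CB MB) (η LX LF LS : ℝ) where
  kerX : ℝ → Xγ →L[ℝ] X₁
  kerF : ℝ → Yδ →L[ℝ] Y₁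
  kerS : ℝ → Yδ →L[ℝ] Y₁
  boundX : ℝ → ℝ
  boundF : ℝ → ℝ
  boundS : ℝ → ℝ
  greenX : IsGreenKernel kerX boundX η LX
  greenF : IsGreenKernel kerF boundF η LF
  greenS : IsGreenKernel kerS boundS η LS
  ι₁_kerX : ∀ r v, S.spX.ι₁ (kerX r v) =
    (Ioi 0).indicator (fun r => (E.scaled hε).op r (ε⁻¹ • S.spX.ι v)) r
  ι₁_kerF : ∀ r v, S.spY.ι₁ (kerF r v) =
    (Ioi 0).indicator (fun r => S.spY.semigroup.op r (S.spY.ι (D.prF v))) r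
  ι₁_kerS : ∀ r v, S.spY.ι₁ (kerS r v) =
    -(Iio 0).indicator (fun r => D.slowFlow r (S.spY.ι v)) r

section Construction

variable {S : System X X₁ Xγ Y Y₁ Yδ} {ε γ δ μ M C βF βS CB MB η : ℝ}

theorem ModifiedSemigroup.exists_kernel [CompleteSpace X] [CompleteSpace X₁]
    (E : ModifiedSemigroup S ε γ μ M C) (hε : 0 < ε) (hγ : 0 < γ) (hC : 0 ≤ C)
    (hη : μ * ε⁻¹ < η) :
    ∃ (K : ℝ → Xγ →L[ℝ] X₁) (k : ℝ → ℝ),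
      IsGreenKernel K k η (C * ε⁻¹ ^ γ * Real.Gamma γ / (η - μ * ε⁻¹) ^ γ) ∧
      ∀ r v, S.spX.ι₁ (K r v) =
        (Ioi 0).indicator (fun r => (E.scaled hε).op r (ε⁻¹ • S.spX.ι v)) r := by
  have hεi : 0 < ε⁻¹ := inv_pos.2 hε
  obtain ⟨T, hT, hT_norm, hT_cont⟩ := (E.isGenerator_scaled hε).exists_smoothing
    (ε⁻¹ • S.spX.ι) (b := fun t => C * ε⁻¹ ^ γ * t ^ (γ - 1) * Real.exp (μ * ε⁻¹ * t))
    (fun t ht => by positivity) fun t ht v => by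
      obtain ⟨z, hz, hz_norm⟩ := E.bound_smoothing _ (mul_pos hεi ht) (ε⁻¹ • v)
      refine ⟨z, hz.trans (by rw [map_smul]; rfl), hz_norm.trans_eq ?_⟩
      rw [norm_smul, Real.norm_of_nonneg hεi.le, Real.mul_rpow hεi.le ht.le,
        Real.rpow_sub_one hεi.ne', mul_assoc μ]
      field_simp
  refine ⟨_, _, IsGreenKernel.forward hγ hη hT_cont hT_norm, fun r v => ?_⟩
  by_cases hr : 0 < r
  · simp [hr, hT r hr]
  · simp [hr]

theorem Splitting.exists_fast_kernel [CompleteSpace Y] [CompleteSpace Y₁]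
    (D : Splitting S.spY δ βF βS CB MB) (hδ : 0 < δ) (hCB : 0 ≤ CB) (hη : βF < η) :
    ∃ (K : ℝ → Yδ →L[ℝ] Y₁) (k : ℝ → ℝ),
      IsGreenKernel K k η (CB * ‖D.prF‖ * Real.Gamma δ / (η - βF) ^ δ) ∧
      ∀ r v, S.spY.ι₁ (K r v) =
        (Ioi 0).indicator (fun r => S.spY.semigroup.op r (S.spY.ι (D.prF v))) r := by
  obtain ⟨T, hT, hT_norm, hT_cont⟩ := S.spY.isGenerator.exists_smoothing (S.spY.ι.comp D.prF)
    (b := fun t => CB * ‖D.prF‖ * t ^ (δ - 1) * Real.exp (βF * t))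
    (fun t ht => by positivity) fun t ht v => by
      obtain ⟨z, hz, hz_norm⟩ := D.bound_fast t ht (D.prF v) (D.P_ι_prF v)
      refine ⟨z, hz, hz_norm.trans ?_⟩
      calc CB * t ^ (δ - 1) * Real.exp (βF * t) * ‖D.prF v‖
          ≤ CB * t ^ (δ - 1) * Real.exp (βF * t) * (‖D.prF‖ * ‖v‖) := by
            gcongr; exact D.prF.le_opNorm v
        _ = CB * ‖D.prF‖ * t ^ (δ - 1) * Real.exp (βF * t) * ‖v‖ := by ring
  refine ⟨_, _, IsGreenKernel.forward hδ hη hT_cont hT_norm, fun r v => ?_⟩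
  by_cases hr : 0 < r
  · simp [hr, hT r hr]
  · simp [hr]

theorem Splitting.exists_slow_kernel (D : Splitting S.spY δ βF βS CB MB) (hMB : 0 ≤ MB)
    (hη : η < βS) :
    ∃ (K : ℝ → Yδ →L[ℝ] Y₁) (k : ℝ → ℝ),
      IsGreenKernel K k η (MB * ‖D.Q‖ / (βS - η)) ∧
      ∀ r v, S.spY.ι₁ (K r v) = -(Iio 0).indicator (fun r => D.slowFlow r (S.spY.ι v)) r := by
  obtain ⟨T, hT, hT_norm, hT_cont⟩ := D.exists_slow_smoothing hMB
  refine ⟨_, _, IsGreenKernel.backward (T := -T) hη (fun v => (hT_cont v).neg)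
    (fun r hr => by simpa using hT_norm r hr), fun r v => ?_⟩
  by_cases hr : r < 0
  · simp [hr, hT r hr]
  · simp [hr]

theorem nonempty_lyapunovPerronKernels [CompleteSpace X] [CompleteSpace X₁] [CompleteSpace Y]
    [CompleteSpace Y₁] (E : ModifiedSemigroup S ε γ μ M C)
    (D : Splitting S.spY δ βF βS CB MB) (hε : 0 < ε) (hγ : 0 < γ) (hδ : 0 < δ) (hC : 0 ≤ C)
    (hCB : 0 ≤ CB) (hMB : 0 ≤ MB) (hX : μ * ε⁻¹ < η) (hF : βF < η) (hS : η < βS) :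
    Nonempty (LyapunovPerronKernels S hε E D η (C * ε⁻¹ ^ γ * Real.Gamma γ / (η - μ * ε⁻¹) ^ γ)
      (CB * ‖D.prF‖ * Real.Gamma δ / (η - βF) ^ δ) (MB * ‖D.Q‖ / (βS - η))) := by
  obtain ⟨KX, kX, hKX, h_kerX⟩ := E.exists_kernel hε hγ hC hX
  obtain ⟨KF, kF, hKF, h_kerF⟩ := D.exists_fast_kernel hδ hCB hF
  obtain ⟨KS, kS, hKS, h_kerS⟩ := D.exists_slow_kernel hMB hS
  exact ⟨⟨KX, KF, KS, kX, kF, kS, hKX, hKF, hKS, h_kerX, h_kerF, h_kerS⟩⟩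

end Construction

theorem contraction_le_gapConst {ε ζ μ γ δ Lf Lg CA CB MB NF NS nF nS η : ℝ}
    (hδ : δ ∈ Ioc (0 : ℝ) 1) (hε : 0 < ε) (hLg : 0 ≤ Lg) (hMB : 0 ≤ MB) (hnS : 0 ≤ nS)
    (hN : NF < NS) (hη : η = ζ⁻¹ * μ + (NS + NF) / 2) (hX : μ * ε⁻¹ < η) :
    Lf * (CA * ε⁻¹ ^ γ * Real.Gamma γ / (η - μ * ε⁻¹) ^ γ) +
        Lg * (CB * nF * Real.Gamma δ / (η - (NF + ζ⁻¹ * μ)) ^ δ) +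
        Lg * (MB * nS / (NS + ζ⁻¹ * μ - η)) ≤
      gapConst ε ζ μ γ δ Lf Lg CA CB MB NF NS nF nS := by
  have h_rate : 2 * (ε * ζ⁻¹ - 1) * μ + ε * (NS + NF) = 2 * ε * (η - μ * ε⁻¹) := by
    rw [hη]; field_simp; ring
  have h_fast : η - (NF + ζ⁻¹ * μ) = (NS - NF) / 2 := by rw [hη]; ring
  have h_slow : NS + ζ⁻¹ * μ - η = (NS - NF) / 2 := by rw [hη]; ring
  have h_gap : 0 < NS - NF := sub_pos.2 hN
  have h_pos : 0 < η - μ * ε⁻¹ := sub_pos.2 hX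
  have h_two (a : ℝ) : (2 : ℝ) ^ a ≠ 0 := (Real.rpow_pos_of_pos two_pos a).ne'
  unfold gapConst
  rw [h_rate, h_fast, h_slow]
  refine add_le_add (add_le_add (le_of_eq ?_) (le_of_eq ?_)) ?_
  · have h_ε : ε ^ γ ≠ 0 := (Real.rpow_pos_of_pos hε γ).ne'
    have h_two_γ := h_two γ
    rw [Real.mul_rpow (by positivity) h_pos.le, Real.mul_rpow zero_le_two hε.le,
      Real.inv_rpow hε.le]
    field_simp
  · have h_two_δ := h_two δ
    rw [Real.div_rpow h_gap.le zero_le_two]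
    field_simp
  · calc Lg * (MB * nS / ((NS - NF) / 2)) = 2 * (Lg * nS) * MB * 1 / (NS - NF) := by field_simp
      _ ≤ 2 * (Lg * nS) * MB * Real.Gamma δ / (NS - NF) := by
        gcongr
        exact one_le_Gamma_of_mem_Ioc hδ

namespace LyapunovPerronKernels

variable {S : System X X₁ Xγ Y Y₁ Yδ} {ε γ μ M C : ℝ} {hε : 0 < ε}
  {E : ModifiedSemigroup S ε γ μ M C} {δ βF βS CB MB : ℝ}
  {D : Splitting S.spY δ βF βS CB MB} {η LX LF LS : ℝ} {lf lg : NNReal}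

/-- The Lyapunov–Perron operator with base point `0`, as a map of curves in the state space. -/
noncomputable def op (K : LyapunovPerronKernels S hε E D η LX LF LS)
    (w : ℝ → SumState X₁ Y₁) (t : ℝ) : SumState X₁ Y₁ :=
  SumState.equiv (conv K.kerX (fun s => onState S.fMod (w s)) t,
    conv K.kerF (fun s => onState S.g (w s)) t, conv K.kerS (fun s => onState S.g (w s)) t)

theorem isWeightedLipschitz_op (K : LyapunovPerronKernels S hε E D η LX LF LS)
    (hf : LipschitzWith lf (onState S.fMod)) (hg : LipschitzWith lg (onState S.g)) :
    IsWeightedLipschitz K.op η (lf * LX + lg * LF + lg * LS) where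
  nonneg := by
    have := K.greenX.nonneg
    have := K.greenF.nonneg
    have := K.greenS.nonneg
    positivity
  map_zero t := by
    have hf0 := (onState_zero S.fMod).trans S.fMod_zero
    have hg0 := (onState_zero S.g).trans S.g_zero
    simp only [op, IsGreenKernel.conv_comp_zero hf0, IsGreenKernel.conv_comp_zero hg0]
    exact map_zero _
  continuousOn w hw := by
    have hwf := hw.comp_lipschitz hf ((onState_zero S.fMod).trans S.fMod_zero)
    have hwg := hw.comp_lipschitz hg ((onState_zero S.g).trans S.g_zero)
    exact (SumState.equiv.continuous.comp ((K.greenX.continuous_conv hwf).prodMk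
      ((K.greenF.continuous_conv hwg).prodMk (K.greenS.continuous_conv hwg)))).continuousOn
  lipschitz w w' hw hw' D hD hd t _ := by
    have hf0 := (onState_zero S.fMod).trans S.fMod_zero
    have hg0 := (onState_zero S.g).trans S.g_zero
    rw [op, op, ← map_sub, SumState.norm_equiv, add_mul, add_mul, add_mul, add_mul]
    exact add_le_add (add_le_add (K.greenX.norm_conv_comp_sub_le hf hf0 hw hw' hD hd t)
      (K.greenF.norm_conv_comp_sub_le hg hg0 hw hw' hD hd t))
      (K.greenS.norm_conv_comp_sub_le hg hg0 hw hw' hD hd t)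

end LyapunovPerronKernels

end System

section FixedPoint

variable {X X₁ Xγ Y Y₁ Yδ : Type*}
  [NormedAddCommGroup X] [NormedSpace ℝ X] [NormedAddCommGroup X₁] [NormedSpace ℝ X₁]
  [NormedAddCommGroup Xγ] [NormedSpace ℝ Xγ]
  [NormedAddCommGroup Y] [NormedSpace ℝ Y] [NormedAddCommGroup Y₁] [NormedSpace ℝ Y₁]
  [NormedAddCommGroup Yδ] [NormedSpace ℝ Yδ]

theorem mem_weightedSpace_iff {sp : Scale Y Y₁ Yδ} {δ βF βS CB MB η : ℝ}
    {D : Splitting sp δ βF βS CB MB} {w : ℝ → X₁ × Y₁ × Y₁} :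
    w ∈ weightedSpace X₁ D η ↔ ContinuousOn w (Iic 0) ∧
      (∀ t ≤ 0, D.IsFast (w t).2.1 ∧ D.IsSlow (w t).2.2) ∧
      ∃ K, ∀ t ≤ 0, ‖SumState.equiv (w t)‖ ≤ K * Real.exp (η * t) := by
  have h_exp (t K : ℝ) : K * Real.exp (η * t) = K / Real.exp (-η * t) := by
    rw [neg_mul, Real.exp_neg, div_inv_eq_mul]
  simp only [weightedSpace, mem_ofPred_eq, SumState.norm_equiv, h_exp,
    le_div_iff₀' (Real.exp_pos _)]

theorem admissible_of_mem_weightedSpace {sp : Scale Y Y₁ Yδ} {δ βF βS CB MB η : ℝ}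
    {D : Splitting sp δ βF βS CB MB} {w : ℝ → X₁ × Y₁ × Y₁} (hw : w ∈ weightedSpace X₁ D η) :
    Admissible η fun t => SumState.equiv (w t) := by
  obtain ⟨h_cont, -, K, hK⟩ := mem_weightedSpace_iff.1 hw
  exact .of_continuousOn (SumState.equiv.continuous.comp_continuousOn h_cont) hK

theorem Splitting.IsSlow.add {sp : Scale Y Y₁ Yδ} {δ βF βS CB MB : ℝ}
    {D : Splitting sp δ βF βS CB MB} {y z : Y₁} (hy : D.IsSlow y) (hz : D.IsSlow z) :
    D.IsSlow (y + z) := by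
  rw [D.isSlow_iff] at *
  rw [map_add, map_add, hy, hz]

variable {S : System X X₁ Xγ Y Y₁ Yδ} {ε γ μ M C : ℝ}

/-- The forcing term `ε⁻¹ f̃(u, v_F + v_S)` of the equation for `u`, in `X`. -/
noncomputable def System.forcingX (S : System X X₁ Xγ Y Y₁ Yδ) (ε : ℝ) (p : X₁ × Y₁ × Y₁) : X :=
  ε⁻¹ • S.spX.ι (S.fMod (p.1, p.2.1 + p.2.2))

/-- The forcing term `pr_F g(u, v_F + v_S)` of the equation for `v_F`, in `Y`. -/
noncomputable def Splitting.forcingF {δ βF βS CB MB : ℝ} (D : Splitting S.spY δ βF βS CB MB)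
    (p : X₁ × Y₁ × Y₁) : Y :=
  S.spY.ι (D.prF (S.g (p.1, p.2.1 + p.2.2)))

/-- The forcing term `g(u, v_F + v_S)` of the equation for `v_S`, in `Y`. It is not projected to
`Y_S`, because the slow flow starts with this projection. -/
noncomputable def System.forcingS (S : System X X₁ Xγ Y Y₁ Yδ) (p : X₁ × Y₁ × Y₁) : Y :=
  S.spY.ι (S.g (p.1, p.2.1 + p.2.2))

theorem integral_semigroup_fMod (hε : 0 < ε) (E : ModifiedSemigroup S ε γ μ M C)
    (w : ℝ → X₁ × Y₁ × Y₁) (t : ℝ) :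
    ε⁻¹ • ∫ s in Iic t, E.semigroup.op (ε⁻¹ * (t - s))
        (S.spX.ι (S.fMod ((w s).1, (w s).2.1 + (w s).2.2))) =
      ∫ s in Iic t, (E.scaled hε).op (t - s) (S.forcingX ε (w s)) := by
  rw [← integral_smul]
  simp only [System.forcingX, map_smul]
  rfl

namespace LyapunovPerronKernels

variable {hε : 0 < ε} {E : ModifiedSemigroup S ε γ μ M C} {δ βF βS CB MB : ℝ}
  {D : Splitting S.spY δ βF βS CB MB} {η LX LF LS : ℝ} {lf lg : NNReal}
  {w : ℝ → X₁ × Y₁ × Y₁} {φ : ℝ → Yδ}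

section

variable [CompleteSpace Y] [CompleteSpace Y₁]

theorem isFast_conv (K : LyapunovPerronKernels S hε E D η LX LF LS) (hφ : Admissible η φ)
    (t : ℝ) : D.IsFast (conv K.kerF φ t) := by
  refine K.greenF.map_conv_eq_zero (j := D.P.comp S.spY.ι₁) hφ (fun r v => ?_) t
  rw [ContinuousLinearMap.comp_apply, K.ι₁_kerF]
  by_cases hr : 0 < r
  · simp [hr, D.P_op hr.le, D.P_ι_prF]
  · simp [hr]

theorem isSlow_conv (K : LyapunovPerronKernels S hε E D η LX LF LS) (hφ : Admissible η φ)
    (t : ℝ) : D.IsSlow (conv K.kerS φ t) := by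
  refine D.isSlow_iff.2 (sub_eq_zero.1 ?_)
  refine K.greenS.map_conv_eq_zero (j := D.P.comp S.spY.ι₁ - S.spY.ι₁) hφ (fun r v => ?_) t
  rw [sub_apply, ContinuousLinearMap.comp_apply, K.ι₁_kerS]
  by_cases hr : r < 0
  · simp [hr, D.P_slowFlow]
  · simp [hr]

end

theorem norm_slow_orbit_le (hη : η ≤ βS) (hMB : 0 ≤ MB) {y₀ : Y₁} {q : ℝ → Y₁}
    (hq : ∀ t ≤ 0, ‖q t‖ ≤ MB * Real.exp (βS * t) * ‖y₀‖) {t : ℝ} (ht : t ≤ 0) :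
    ‖SumState.equiv ((0, 0, q t) : X₁ × Y₁ × Y₁)‖ ≤ MB * ‖y₀‖ * Real.exp (η * t) := by
  simp only [SumState.norm_equiv, norm_zero, zero_add]
  calc ‖q t‖ ≤ MB * Real.exp (βS * t) * ‖y₀‖ := hq t ht
    _ ≤ MB * Real.exp (η * t) * ‖y₀‖ := by
      gcongr 1
      exact mul_le_mul_of_nonneg_left
        (Real.exp_le_exp.2 (mul_le_mul_of_nonpos_right hη ht)) hMB
    _ = MB * ‖y₀‖ * Real.exp (η * t) := by ring

variable [CompleteSpace X] [CompleteSpace X₁] [CompleteSpace Y] [CompleteSpace Y₁]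

theorem eq_add_op_iff (K : LyapunovPerronKernels S hε E D η LX LF LS)
    (hf : LipschitzWith lf (onState S.fMod)) (hg : LipschitzWith lg (onState S.g))
    (hw : Admissible η fun t => SumState.equiv (w t)) {t : ℝ} (ht : t ≤ 0) (p : X₁ × Y₁ × Y₁) :
    SumState.equiv (w t) = SumState.equiv p + K.op (fun t => SumState.equiv (w t)) t ↔
      S.spX.ι₁ (w t).1 = S.spX.ι₁ p.1 +
        ∫ s in Iic t, (E.scaled hε).op (t - s) (S.forcingX ε (w s)) ∧
      S.spY.ι₁ (w t).2.1 = S.spY.ι₁ p.2.1 +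
        ∫ s in Iic t, S.spY.semigroup.op (t - s) (D.forcingF (w s)) ∧
      S.spY.ι₁ (w t).2.2 = S.spY.ι₁ p.2.2 +
        ∫ s in (0 : ℝ)..t, D.slowFlow (t - s) (S.forcingS (w s)) := by
  have hwf := hw.comp_lipschitz hf ((onState_zero S.fMod).trans S.fMod_zero)
  have hwg := hw.comp_lipschitz hg ((onState_zero S.g).trans S.g_zero)
  have hX := K.greenX.map_conv_forward hwf K.ι₁_kerX ht
  have hF := K.greenF.map_conv_forward hwg K.ι₁_kerF ht
  have hS := K.greenS.map_conv_backward hwg K.ι₁_kerS ht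
  rw [op, ← map_add, SumState.equiv.injective.eq_iff]
  simp only [onState_equiv] at hX hF hS ⊢
  simp only [System.forcingX, Splitting.forcingF, System.forcingS]
  rw [← hX, ← hF, ← hS, ← map_add, ← map_add, ← map_add, S.spX.isGenerator.1.eq_iff,
    S.spY.isGenerator.1.eq_iff, S.spY.isGenerator.1.eq_iff]
  simp only [Prod.ext_iff, Prod.fst_add, Prod.snd_add]

theorem isFixedPoint_iff (K : LyapunovPerronKernels S hε E D η LX LF LS)
    (hf : LipschitzWith lf (onState S.fMod)) (hg : LipschitzWith lg (onState S.g))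
    (hw : Admissible η fun t => SumState.equiv (w t)) {y₀ : Y₁} {q : ℝ → Y₁}
    (hq : ∀ t ≤ 0, S.spY.ι₁ (q t) = D.slowFlow t (S.spY.ι₁ y₀)) :
    IsFixedPoint S E D y₀ w ↔ ∀ t ≤ 0, SumState.equiv (w t) =
      SumState.equiv (0, 0, q t) + K.op (fun t => SumState.equiv (w t)) t := by
  refine forall₂_congr fun t ht => ?_
  rw [K.eq_add_op_iff hf hg hw ht, map_zero, map_zero, zero_add, zero_add, hq t ht,
    ← integral_semigroup_fMod hε]
  rfl

theorem exists_isFixedPoint (K : LyapunovPerronKernels S hε E D η LX LF LS)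
    (hf : LipschitzWith lf (onState S.fMod)) (hg : LipschitzWith lg (onState S.g))
    (hL : lf * LX + lg * LF + lg * LS < 1) (hη : η ≤ βS) (hMB : 0 ≤ MB) {y₀ : Y₁}
    (hy : D.IsSlow y₀) :
    ∃ w ∈ weightedSpace X₁ D η, IsFixedPoint S E D y₀ w := by
  obtain ⟨q, hqc, hq⟩ := D.exists_slow_orbit hy
  have hq_slow (t) (ht : t ≤ 0) : D.IsSlow (q t) := D.isSlow_of_ι₁_eq_slowFlow (hq t ht).1
  obtain ⟨x, hxc, ⟨R, hR⟩, hx⟩ := (K.isWeightedLipschitz_op hf hg).exists_solution hL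
    (SumState.equiv.continuous.comp_continuousOn
      (continuousOn_const.prodMk (continuousOn_const.prodMk hqc)))
    (fun t ht => norm_slow_orbit_le hη hMB (fun t ht => (hq t ht).2) ht)
  set w : ℝ → X₁ × Y₁ × Y₁ := fun t => SumState.equiv.symm (x t)
  have hwx : (fun t => SumState.equiv (w t)) = x := by
    ext1 t; exact SumState.equiv.apply_symm_apply _
  have hx_adm : Admissible η x := .of_continuousOn hxc hR
  have hwg := hx_adm.comp_lipschitz hg ((onState_zero S.g).trans S.g_zero)
  have hw_eq (t) (ht : t ≤ 0) : w t = (0, 0, q t) + SumState.equiv.symm (K.op x t) := by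
    rw [← SumState.equiv.injective.eq_iff, map_add, SumState.equiv.apply_symm_apply,
      SumState.equiv.apply_symm_apply, hx t ht]
    rfl
  refine ⟨w, mem_weightedSpace_iff.2
    ⟨SumState.equiv.symm.continuous.comp_continuousOn hxc, fun t ht => ?_, R, fun t ht => ?_⟩,
    (K.isFixedPoint_iff hf hg (hwx ▸ hx_adm) fun t ht => (hq t ht).1).2 fun t ht => ?_⟩
  · rw [hw_eq t ht, op, ContinuousLinearEquiv.symm_apply_apply]
    have hq_add := (hq_slow t ht).add (K.isSlow_conv hwg t)
    simpa using ⟨K.isFast_conv hwg t, hq_add⟩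
  · rw [congrFun hwx t]
    exact hR t ht
  · rw [hwx, congrFun hwx t]
    exact hx t ht

theorem eqOn_of_isFixedPoint (K : LyapunovPerronKernels S hε E D η LX LF LS)
    (hf : LipschitzWith lf (onState S.fMod)) (hg : LipschitzWith lg (onState S.g))
    (hL : lf * LX + lg * LF + lg * LS < 1) {y₀ : Y₁} (hy : D.IsSlow y₀)
    {w w' : ℝ → X₁ × Y₁ × Y₁} (hw : w ∈ weightedSpace X₁ D η) (hwf : IsFixedPoint S E D y₀ w)
    (hw' : w' ∈ weightedSpace X₁ D η) (hwf' : IsFixedPoint S E D y₀ w') :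
    EqOn w' w (Iic 0) := by
  obtain ⟨q, -, hq⟩ := D.exists_slow_orbit hy
  have h_adm := admissible_of_mem_weightedSpace hw
  have h_adm' := admissible_of_mem_weightedSpace hw'
  intro t ht
  have h_norm := (K.isWeightedLipschitz_op hf hg).norm_sub_le (R := 0) hL h_adm' h_adm
    ((K.isFixedPoint_iff hf hg h_adm' fun t ht => (hq t ht).1).1 hwf')
    ((K.isFixedPoint_iff hf hg h_adm fun t ht => (hq t ht).1).1 hwf) (fun s _ => by simp) ht
  rw [zero_div, zero_mul, norm_le_zero_iff, sub_eq_zero] at h_norm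
  exact SumState.equiv.injective h_norm

theorem slowMap_spec (K : LyapunovPerronKernels S hε E D η LX LF LS)
    (hf : LipschitzWith lf (onState S.fMod)) (hg : LipschitzWith lg (onState S.g))
    (hL : lf * LX + lg * LF + lg * LS < 1) (hη : η ≤ βS) (hMB : 0 ≤ MB) {y₀ : Y₁}
    (hy : D.IsSlow y₀) :
    ∃ w ∈ weightedSpace X₁ D η, IsFixedPoint S E D y₀ w ∧
      slowMap S E D η y₀ = ((w 0).1, (w 0).2.1) := by
  obtain ⟨w, hw⟩ := K.exists_isFixedPoint hf hg hL hη hMB hy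
  have h_eps := Classical.epsilon_spec (p := fun w => w ∈ weightedSpace X₁ D η ∧
    IsFixedPoint S E D y₀ w) ⟨w, hw⟩
  exact ⟨_, h_eps.1, h_eps.2, rfl⟩

end LyapunovPerronKernels

end FixedPoint

theorem integral_Iic_comp_add_right {Z : Type*} [NormedAddCommGroup Z] [NormedSpace ℝ Z]
    (f : ℝ → Z) (s t : ℝ) : ∫ q in Iic s, f (q + t) = ∫ q in Iic (s + t), f q := by
  have h_preimage : (· + t) ⁻¹' Iic (s + t) = Iic s := by simp
  rw [← h_preimage]
  exact (measurePreserving_add_right volume t).setIntegral_preimage_emb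
    (measurableEmbedding_addRight t) f (Iic (s + t))

section Concat

variable {E Z : Type*} {t s r : ℝ} {x₀ x : ℝ → E}

/-- The curve on `(-∞, 0]` that follows `x₀` up to its time `0` and then `x` on `[0, t]`, with time
shifted so that it ends at time `0`. It may jump at time `-t`, where the value is `x 0`. -/
noncomputable def concat (t : ℝ) (x₀ x : ℝ → E) (s : ℝ) : E :=
  if s < -t then x₀ (s + t) else x (s + t)

theorem concat_of_lt (hs : s < -t) : concat t x₀ x s = x₀ (s + t) := if_pos hs

theorem concat_of_le (hs : -t ≤ s) : concat t x₀ x s = x (s + t) := if_neg hs.not_gt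

theorem Admissible.concat [NormedAddCommGroup E] [NormedSpace ℝ E] {η D : ℝ}
    (hx₀ : ContinuousOn x₀ (Iic 0)) (hD : ∀ s ≤ 0, ‖x₀ s‖ ≤ D * Real.exp (η * s))
    (hx : ContinuousOn x (Icc 0 t)) : Admissible η (concat t x₀ x) := by
  refine ⟨⟨-t, ContinuousOn.if (fun s hs => ?_) ?_ ?_⟩, ?_⟩
  · exact absurd (frontier_Iio (a := -t) ▸ hs.2) hs.1.2
  · refine hx₀.comp (by fun_prop) fun s hs => ?_
    have hst : s ∈ Iic (-t) := closure_Iio (-t) ▸ hs.2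
    exact mem_Iic.2 (by linarith [mem_Iic.1 hst])
  · refine hx.comp (by fun_prop) fun s hs => ?_
    have hst : s ∈ Ici (-t) := by simpa only [not_lt, Ici_def, closure_Ici] using hs.2
    exact ⟨by linarith [mem_Ici.1 hst], by linarith [mem_Iic.1 hs.1.1]⟩
  · obtain ⟨C, hC⟩ := isCompact_Icc.exists_bound_of_continuousOn
      (f := fun r => Real.exp (-(η * r)) • x r) (by fun_prop)
    refine ⟨max D C * Real.exp (η * t), fun s hs => ?_⟩
    have h_exp : Real.exp (η * t) * Real.exp (η * s) = Real.exp (η * (s + t)) := by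
      rw [← Real.exp_add]; ring_nf
    rw [mul_assoc, h_exp]
    rcases lt_or_ge s (-t) with hst | hst
    · rw [concat_of_lt hst]
      refine (hD _ (by linarith)).trans ?_
      gcongr
      exact le_max_left D C
    · rw [concat_of_le hst]
      have h_bound := hC (s + t) ⟨by linarith, by linarith⟩
      rw [norm_smul, Real.norm_eq_abs, Real.abs_exp, Real.exp_neg,
        inv_mul_le_iff₀ (Real.exp_pos _), mul_comm] at h_bound
      refine h_bound.trans ?_
      gcongr
      exact le_max_right D C

variable [NormedAddCommGroup Z] [NormedSpace ℝ Z]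

theorem integral_Iic_concat (F : ℝ → E → Z) (r : ℝ) (hs : s ≤ -t) :
    ∫ q in Iic s, F (r - q) (concat t x₀ x q) =
      ∫ q in Iic (s + t), F (r + t - q) (x₀ q) := by
  rw [integral_Iic_eq_integral_Iio, ← integral_Iic_comp_add_right, integral_Iic_eq_integral_Iio]
  refine setIntegral_congr_fun measurableSet_Iio fun q (hq : q < s) => ?_
  simp only [concat_of_lt (hq.trans_le hs), add_sub_add_right_eq_sub]

theorem integral_concat_left (F : ℝ → E → Z) (r : ℝ) (hs : s ≤ -t) :
    ∫ q in (-t)..s, F (r - q) (concat t x₀ x q) =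
      ∫ q in (0 : ℝ)..(s + t), F (r + t - q) (x₀ q) := by
  rw [← neg_add_cancel t, ← intervalIntegral.integral_comp_add_right]
  refine intervalIntegral.integral_congr_uIoo fun q hq => ?_
  rw [uIoo_of_ge hs] at hq
  simp only [concat_of_lt hq.2, add_sub_add_right_eq_sub]

theorem integral_concat_right (F : ℝ → E → Z) (r : ℝ) (hs : -t ≤ s) :
    ∫ q in (-t)..s, F (r - q) (concat t x₀ x q) =
      ∫ q in (0 : ℝ)..(s + t), F (r + t - q) (x q) := by
  rw [← neg_add_cancel t, ← intervalIntegral.integral_comp_add_right]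
  refine intervalIntegral.integral_congr fun q hq => ?_
  rw [uIcc_of_le hs] at hq
  simp only [concat_of_le hq.1, add_sub_add_right_eq_sub]

end Concat

section Mild

variable {E X : Type*} [NormedAddCommGroup X] [NormedSpace ℝ X] [CompleteSpace X]

theorem C0Semigroup.integral_Iic_op_sub (S : C0Semigroup X) {φ : ℝ → X} {r s : ℝ} (hrs : r ≤ s)
    (hr : IntegrableOn (fun q => S.op (r - q) (φ q)) (Iic r))
    (hs : IntegrableOn (fun q => S.op (s - q) (φ q)) (Iic s)) :
    ∫ q in Iic s, S.op (s - q) (φ q) =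
      S.op (s - r) (∫ q in Iic r, S.op (r - q) (φ q)) + ∫ q in r..s, S.op (s - q) (φ q) := by
  have h_past : S.op (s - r) (∫ q in Iic r, S.op (r - q) (φ q)) =
      ∫ q in Iic r, S.op (s - q) (φ q) := by
    rw [← ContinuousLinearMap.integral_comp_comm _ hr]
    refine setIntegral_congr_fun measurableSet_Iic fun q (hq : q ≤ r) => ?_
    simp only [← S.op_add_apply (sub_nonneg.2 hrs) (sub_nonneg.2 hq), sub_add_sub_cancel]
  rw [h_past, ← intervalIntegral.integral_Iic_sub_Iic (hs.mono_set (Iic_subset_Iic.2 hrs)) hs,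
    add_sub_cancel]

theorem C0Semigroup.integral_Iic_concat_eq (S : C0Semigroup X) {N : E → X} {x₀ x : ℝ → E}
    {t s : ℝ} (hs : -t ≤ s)
    (h_int : ∀ r ≤ s, IntegrableOn (fun q => S.op (r - q) (N (concat t x₀ x q))) (Iic r)) :
    ∫ q in Iic s, S.op (s - q) (N (concat t x₀ x q)) =
      S.op (s + t) (∫ q in Iic (0 : ℝ), S.op (0 - q) (N (x₀ q))) +
        ∫ q in (0 : ℝ)..(s + t), S.op (s + t - q) (N (x q)) := by
  rw [S.integral_Iic_op_sub hs (h_int _ hs) (h_int s le_rfl),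
    integral_Iic_concat (fun r v => S.op r (N v)) _ le_rfl,
    integral_concat_right (fun r v => S.op r (N v)) _ hs, neg_add_cancel, sub_neg_eq_add]

namespace Splitting

variable {Y Y₁ Yδ : Type*} [NormedAddCommGroup Y] [NormedSpace ℝ Y]
  [NormedAddCommGroup Y₁] [NormedSpace ℝ Y₁] [NormedAddCommGroup Yδ] [NormedSpace ℝ Yδ]
  {sp : Scale Y Y₁ Yδ} {δ βF βS CB MB : ℝ} (D : Splitting sp δ βF βS CB MB)

theorem intervalIntegrable_slowFlow {φ : ℝ → Y} {a : ℝ} (ha : a ≤ 0)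
    (h : IntegrableOn (fun q => D.slowFlow (a - q) (φ q)) (Ioc a 0)) (s : ℝ) :
    IntervalIntegrable (fun q => D.slowFlow (s - q) (φ q)) volume a 0 := by
  rw [intervalIntegrable_iff_integrableOn_Ioc_of_le ha]
  refine ((D.slowFlowCLM (s - a)).integrable_comp h).congr (Eventually.of_forall fun q => ?_)
  simp only [slowFlowCLM_apply, ← D.slowFlow_add, sub_add_sub_cancel]

variable [CompleteSpace Y]

-- The slow equation may be based at any time, because the slow flow is a group.
theorem slowFlow_rebase {φ : ℝ → Y}
    (h : ∀ a ≤ 0, IntegrableOn (fun q => D.slowFlow (a - q) (φ q)) (Ioc a 0))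
    {r s : ℝ} (hr : r ≤ 0) (hs : s ≤ 0) (y : Y) :
    D.slowFlow s (D.slowFlow (0 - r) y + ∫ q in r..0, D.slowFlow (0 - q) (φ q)) +
        ∫ q in (0 : ℝ)..s, D.slowFlow (s - q) (φ q) =
      D.slowFlow (s - r) y + ∫ q in r..s, D.slowFlow (s - q) (φ q) := by
  have h_int {a : ℝ} (ha : a ≤ 0) := D.intervalIntegrable_slowFlow ha (h a ha)
  have h_flow : D.slowFlow s (∫ q in r..0, D.slowFlow (0 - q) (φ q)) =
      ∫ q in r..0, D.slowFlow (s - q) (φ q) := by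
    rw [← slowFlowCLM_apply, ← ContinuousLinearMap.intervalIntegral_comp_comm _ (h_int hr 0)]
    simp only [slowFlowCLM_apply, ← D.slowFlow_add, add_sub_assoc', add_zero]
  rw [← slowFlowCLM_apply, map_add, slowFlowCLM_apply, slowFlowCLM_apply, h_flow,
    ← D.slowFlow_add, add_sub_assoc', add_zero, add_assoc,
    intervalIntegral.integral_add_adjacent_intervals (h_int hr s) (h_int hs s).symm]

theorem slowFlow_concat {N : E → Y} {x₀ x : ℝ → E} {t s : ℝ}
    (h : ∀ a ≤ 0, IntegrableOn (fun q => D.slowFlow (a - q) (N (concat t x₀ x q))) (Ioc a 0))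
    (ht : 0 ≤ t) (hs : s ≤ 0) (y : Y) :
    D.slowFlow s (D.slowFlow t y + ∫ q in (0 : ℝ)..t, D.slowFlow (t - q) (N (x q))) +
        ∫ q in (0 : ℝ)..s, D.slowFlow (s - q) (N (concat t x₀ x q)) =
      D.slowFlow (s + t) y + ∫ q in (-t)..s, D.slowFlow (s - q) (N (concat t x₀ x q)) := by
  have h_rebase := D.slowFlow_rebase h (neg_nonpos.2 ht) hs y
  rwa [integral_concat_right (fun r v => D.slowFlow r (N v)) 0 (neg_nonpos.2 ht), sub_neg_eq_add,
    sub_neg_eq_add, zero_add] at h_rebase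

end Splitting

end Mild

section Attraction

variable {X X₁ Xγ Y Y₁ Yδ : Type*}
  [NormedAddCommGroup X] [NormedSpace ℝ X] [NormedAddCommGroup X₁] [NormedSpace ℝ X₁]
  [NormedAddCommGroup Xγ] [NormedSpace ℝ Xγ]
  [NormedAddCommGroup Y] [NormedSpace ℝ Y] [NormedAddCommGroup Y₁] [NormedSpace ℝ Y₁]
  [NormedAddCommGroup Yδ] [NormedSpace ℝ Yδ]
  {S : System X X₁ Xγ Y Y₁ Yδ} {ε γ μ M C δ βF βS CB MB : ℝ} {hε : 0 < ε}
  {E : ModifiedSemigroup S ε γ μ M C} {D : Splitting S.spY δ βF βS CB MB}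
  {T t s : ℝ} {u : ℝ → X₁} {vF vS : ℝ → Y₁}

theorem System.continuous_fMod (S : System X X₁ Xγ Y Y₁ Yδ) : Continuous S.fMod :=
  S.f_contDiff.continuous.sub (S.Dxf.continuous.comp continuous_fst)

theorem System.gen_add_forcing (S : System X X₁ Xγ Y Y₁ Yδ) (hε : ε ≠ 0) (p : X₁ × Y₁ × Y₁) :
    S.spX.gen p.1 + ε⁻¹ • S.spX.ι (S.f (p.1, p.2.1 + p.2.2)) =
      (ε⁻¹ • S.genMod ε) p.1 + S.forcingX ε p := by
  simp only [System.genMod, System.forcingX, System.fMod, smul_apply, add_apply,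
    ContinuousLinearMap.comp_apply, smul_add, map_sub, smul_sub, inv_smul_smul₀ hε]
  abel

namespace IsStrictSolution

theorem continuousOn (h : IsStrictSolution S ε D T u vF vS) :
    ContinuousOn (fun s => (u s, vF s, vS s)) (Icc 0 T) :=
  h.continuousOn_u.prodMk (h.continuousOn_vF.prodMk h.continuousOn_vS)

theorem continuousOn_sum (h : IsStrictSolution S ε D T u vF vS) :
    ContinuousOn (fun s => (u s, vF s + vS s)) (Icc 0 T) :=
  h.continuousOn_u.prodMk (h.continuousOn_vF.add h.continuousOn_vS)

theorem mild_u [CompleteSpace X] (h : IsStrictSolution S ε D T u vF vS) (hε : 0 < ε)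
    (E : ModifiedSemigroup S ε γ μ M C) (ht : t ∈ Icc 0 T) :
    S.spX.ι₁ (u t) = (E.scaled hε).op t (S.spX.ι₁ (u 0)) +
      ∫ s in (0 : ℝ)..t, (E.scaled hε).op (t - s) (S.forcingX ε (u s, vF s, vS s)) := by
  refine (E.isGenerator_scaled hε).variation_of_constants
    (((S.spX.ι.continuous.comp S.continuous_fMod).comp_continuousOn
      h.continuousOn_sum).const_smul ε⁻¹) (fun r hr => ?_) ht
  have h_deriv := h.deriv_u r hr
  rwa [S.gen_add_forcing hε.ne' (u r, vF r, vS r)] at h_deriv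

variable [CompleteSpace Y]

theorem mild_vF (h : IsStrictSolution S ε D T u vF vS) (ht : t ∈ Icc 0 T) :
    S.spY.ι₁ (vF t) = S.spY.semigroup.op t (S.spY.ι₁ (vF 0)) +
      ∫ s in (0 : ℝ)..t, S.spY.semigroup.op (t - s) (D.forcingF (u s, vF s, vS s)) :=
  S.spY.isGenerator.variation_of_constants ((S.spY.ι.comp D.prF).continuous.comp_continuousOn
    (S.g_contDiff.continuous.comp_continuousOn h.continuousOn_sum)) h.deriv_vF ht

theorem mild_vS (h : IsStrictSolution S ε D T u vF vS) (ht : t ∈ Icc 0 T) :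
    S.spY.ι₁ (vS t) = D.slowFlow t (S.spY.ι₁ (vS 0)) +
      ∫ s in (0 : ℝ)..t, D.slowFlow (t - s) (S.forcingS (u s, vF s, vS s)) := by
  have h_flow {r : ℝ} (hr : 0 ≤ r) (y : Y) : D.slowFlow r y = S.spY.semigroup.op r (D.P y) :=
    D.slowFlow_of_nonneg hr y
  have h_start : D.P (S.spY.ι₁ (vS 0)) = S.spY.ι₁ (vS 0) :=
    D.isSlow_iff.1 (h.slow 0 ⟨le_rfl, ht.1.trans ht.2⟩)
  rw [S.spY.isGenerator.variation_of_constants ((D.P.comp S.spY.ι).continuous.comp_continuousOn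
    (S.g_contDiff.continuous.comp_continuousOn h.continuousOn_sum)) h.deriv_vS ht,
    h_flow ht.1, h_start]
  congr 1
  refine intervalIntegral.integral_congr fun s hs => ?_
  rw [uIcc_of_le ht.1] at hs
  exact (h_flow (sub_nonneg.2 hs.2) _).symm

end IsStrictSolution

namespace LyapunovPerronKernels

variable {η LX LF LS : ℝ} {lf lg : NNReal} {w₀ : ℝ → X₁ × Y₁ × Y₁} {q : ℝ → Y₁}

theorem admissible_concat (hw₀ : w₀ ∈ weightedSpace X₁ D η)
    (h : IsStrictSolution S ε D T u vF vS) (ht : t ≤ T) :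
    Admissible η fun s => SumState.equiv (concat t w₀ (fun s => (u s, vF s, vS s)) s) := by
  obtain ⟨h_cont, -, R, hR⟩ := mem_weightedSpace_iff.1 hw₀
  have h_sol := h.continuousOn.mono (Icc_subset_Icc_right ht)
  convert Admissible.concat (SumState.equiv.continuous.comp_continuousOn h_cont) hR
    (SumState.equiv.continuous.comp_continuousOn h_sol) using 2 with s
  exact apply_ite _ _ _ _

theorem exists_norm_domainOp_add_le (E : ModifiedSemigroup S ε γ μ M C)
    (D : Splitting S.spY δ βF βS CB MB) (hε : 0 < ε) (hM : 0 ≤ M) (hδ : δ ≤ 1) (hCB : 0 ≤ CB)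
    (hX : μ * ε⁻¹ ≤ η) (hF : βF ≤ η) (hη : η ≤ 0) :
    ∃ c, 0 < c ∧ ∀ (x : X₁) (y : Y₁), D.IsFast y → ∀ r, 0 ≤ r →
      ‖(E.isGenerator_scaled hε).domainOp r x‖ + ‖S.spY.isGenerator.domainOp r y‖ ≤
        c * Real.exp (η * r) * (‖x‖ + ‖y‖) := by
  obtain ⟨c, hc, h_fast⟩ := D.exists_fast_bound hδ hCB hF hη
  refine ⟨M + c + 1, by positivity, fun x y hy r hr => ?_⟩
  have h_u : ‖(E.isGenerator_scaled hε).domainOp r x‖ ≤ M * Real.exp (η * r) * ‖x‖ := by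
    obtain ⟨z, hz, hz_norm⟩ := E.bound_one (ε⁻¹ * r) (by positivity) x
    have h_eq : (E.isGenerator_scaled hε).domainOp r x = z :=
      S.spX.isGenerator.1 (((E.isGenerator_scaled hε).ι_domainOp hr x).trans hz.symm)
    rw [h_eq]
    refine hz_norm.trans ?_
    rw [← mul_assoc]
    gcongr
  rw [mul_add]
  exact add_le_add (h_u.trans (by gcongr; linarith))
    ((h_fast y hy r hr).trans (by gcongr; linarith))

theorem integrableOn_forcingX (K : LyapunovPerronKernels S hε E D η LX LF LS)
    (hf : LipschitzWith lf (onState S.fMod)) {w : ℝ → X₁ × Y₁ × Y₁}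
    (hw : Admissible η fun t => SumState.equiv (w t)) (ht : t ≤ 0) :
    IntegrableOn (fun s => (E.scaled hε).op (t - s) (S.forcingX ε (w s))) (Iic t) := by
  simpa only [System.forcingX, onState_equiv] using K.greenX.integrableOn_forward
    (hw.comp_lipschitz hf ((onState_zero S.fMod).trans S.fMod_zero)) K.ι₁_kerX ht

theorem integrableOn_forcingF (K : LyapunovPerronKernels S hε E D η LX LF LS)
    (hg : LipschitzWith lg (onState S.g)) {w : ℝ → X₁ × Y₁ × Y₁}
    (hw : Admissible η fun t => SumState.equiv (w t)) (ht : t ≤ 0) :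
    IntegrableOn (fun s => S.spY.semigroup.op (t - s) (D.forcingF (w s))) (Iic t) := by
  simpa only [Splitting.forcingF, onState_equiv] using K.greenF.integrableOn_forward
    (hw.comp_lipschitz hg ((onState_zero S.g).trans S.g_zero)) K.ι₁_kerF ht

theorem integrableOn_forcingS (K : LyapunovPerronKernels S hε E D η LX LF LS)
    (hg : LipschitzWith lg (onState S.g)) {w : ℝ → X₁ × Y₁ × Y₁}
    (hw : Admissible η fun t => SumState.equiv (w t)) (t : ℝ) :
    IntegrableOn (fun s => D.slowFlow (t - s) (S.forcingS (w s))) (Ioc t 0) := by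
  simpa only [System.forcingS, onState_equiv] using K.greenS.integrableOn_backward
    (hw.comp_lipschitz hg ((onState_zero S.g).trans S.g_zero)) K.ι₁_kerS t

variable [CompleteSpace Y]

theorem slow_eq_concat (K : LyapunovPerronKernels S hε E D η LX LF LS)
    (hg : LipschitzWith lg (onState S.g)) (hw₀ : w₀ ∈ weightedSpace X₁ D η)
    (h : IsStrictSolution S ε D T u vF vS) (ht : t ∈ Icc 0 T) (hs : s ≤ 0) :
    D.slowFlow s (S.spY.ι₁ (vS t)) + ∫ r in (0 : ℝ)..s,
        D.slowFlow (s - r) (S.forcingS (concat t w₀ (fun s => (u s, vF s, vS s)) r)) =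
      D.slowFlow (s + t) (S.spY.ι₁ (vS 0)) + ∫ r in (-t)..s,
        D.slowFlow (s - r) (S.forcingS (concat t w₀ (fun s => (u s, vF s, vS s)) r)) := by
  rw [h.mild_vS ht]
  exact D.slowFlow_concat
    (fun a _ => K.integrableOn_forcingS hg (admissible_concat hw₀ h ht.2) a) ht.1 hs _

variable [CompleteSpace X] [CompleteSpace X₁] [CompleteSpace Y₁]

theorem concat_eq_of_lt (K : LyapunovPerronKernels S hε E D η LX LF LS)
    (hf : LipschitzWith lf (onState S.fMod)) (hg : LipschitzWith lg (onState S.g))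
    (hw₀ : w₀ ∈ weightedSpace X₁ D η) (hfix : IsFixedPoint S E D (vS 0) w₀)
    (h : IsStrictSolution S ε D T u vF vS) (ht : t ∈ Icc 0 T)
    (hq : S.spY.ι₁ (q s) = D.slowFlow s (S.spY.ι₁ (vS t))) (hs : s < -t) :
    SumState.equiv (concat t w₀ (fun s => (u s, vF s, vS s)) s) = SumState.equiv (0, 0, q s) +
      K.op (fun s => SumState.equiv (concat t w₀ (fun s => (u s, vF s, vS s)) s)) s := by
  have hs0 : s ≤ 0 := by linarith [ht.1]
  obtain ⟨h_u, h_vF, h_vS⟩ := hfix (s + t) (by linarith)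
  rw [integral_semigroup_fMod hε] at h_u
  refine (K.eq_add_op_iff hf hg (admissible_concat hw₀ h ht.2) hs0 _).2 ⟨?_, ?_, ?_⟩
  · rw [concat_of_lt hs, h_u, map_zero, zero_add]
    exact (integral_Iic_concat (fun r p => (E.scaled hε).op r (S.forcingX ε p)) s hs.le).symm
  · rw [concat_of_lt hs, h_vF, map_zero, zero_add]
    exact (integral_Iic_concat (fun r p => S.spY.semigroup.op r (D.forcingF p)) s hs.le).symm
  · rw [concat_of_lt hs, h_vS, hq, K.slow_eq_concat hg hw₀ h ht hs0,
      integral_concat_left (fun r p => D.slowFlow r (S.forcingS p)) s hs.le]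
    rfl

theorem concat_eq_of_le (K : LyapunovPerronKernels S hε E D η LX LF LS)
    (hf : LipschitzWith lf (onState S.fMod)) (hg : LipschitzWith lg (onState S.g))
    (hw₀ : w₀ ∈ weightedSpace X₁ D η) (hfix : IsFixedPoint S E D (vS 0) w₀)
    (h : IsStrictSolution S ε D T u vF vS) (ht : t ∈ Icc 0 T)
    (hq : S.spY.ι₁ (q s) = D.slowFlow s (S.spY.ι₁ (vS t))) (hs : -t ≤ s) (hs0 : s ≤ 0) :
    SumState.equiv (concat t w₀ (fun s => (u s, vF s, vS s)) s) =
      SumState.equiv ((E.isGenerator_scaled hε).domainOp (s + t) (u 0 - (w₀ 0).1),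
        S.spY.isGenerator.domainOp (s + t) (vF 0 - (w₀ 0).2.1), q s) +
      K.op (fun s => SumState.equiv (concat t w₀ (fun s => (u s, vF s, vS s)) s)) s := by
  have h_adm := admissible_concat hw₀ h ht.2
  have h_nonneg : 0 ≤ s + t := by linarith
  have h_mem : s + t ∈ Icc 0 T := ⟨h_nonneg, by linarith [ht.2]⟩
  obtain ⟨h_u, h_vF, -⟩ := hfix 0 le_rfl
  rw [integral_semigroup_fMod hε] at h_u
  refine (K.eq_add_op_iff hf hg h_adm hs0 _).2 ⟨?_, ?_, ?_⟩
  · rw [concat_of_le hs, h.mild_u hε E h_mem, IsGenerator.ι_domainOp _ h_nonneg, map_sub, map_sub,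
      (E.scaled hε).integral_Iic_concat_eq hs
        fun r hr => K.integrableOn_forcingX hf h_adm (hr.trans hs0), ← h_u, ← add_assoc,
      sub_add_cancel]
  · rw [concat_of_le hs, h.mild_vF h_mem, IsGenerator.ι_domainOp _ h_nonneg, map_sub, map_sub,
      S.spY.semigroup.integral_Iic_concat_eq hs
        fun r hr => K.integrableOn_forcingF hg h_adm (hr.trans hs0)]
    simp only [Splitting.forcingF] at h_vF ⊢
    rw [← h_vF, ← add_assoc, sub_add_cancel]
  · rw [concat_of_le hs, h.mild_vS h_mem, hq, K.slow_eq_concat hg hw₀ h ht hs0,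
      integral_concat_right (fun r p => D.slowFlow r (S.forcingS p)) s hs]

theorem norm_concat_sub_op_le (K : LyapunovPerronKernels S hε E D η LX LF LS)
    (hf : LipschitzWith lf (onState S.fMod)) (hg : LipschitzWith lg (onState S.g))
    (hw₀ : w₀ ∈ weightedSpace X₁ D η) (hfix : IsFixedPoint S E D (vS 0) w₀)
    (h : IsStrictSolution S ε D T u vF vS) (ht : t ∈ Icc 0 T) {c : ℝ} (hc : 0 ≤ c)
    (h_bound : ∀ r, 0 ≤ r →
      ‖(E.isGenerator_scaled hε).domainOp r (u 0 - (w₀ 0).1)‖ +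
        ‖S.spY.isGenerator.domainOp r (vF 0 - (w₀ 0).2.1)‖ ≤ c * Real.exp (η * r))
    (hq : ∀ s ≤ 0, S.spY.ι₁ (q s) = D.slowFlow s (S.spY.ι₁ (vS t))) (hs : s ≤ 0) :
    ‖SumState.equiv (concat t w₀ (fun s => (u s, vF s, vS s)) s) -
        K.op (fun s => SumState.equiv (concat t w₀ (fun s => (u s, vF s, vS s)) s)) s -
        SumState.equiv (0, 0, q s)‖ ≤ c * Real.exp (η * t) * Real.exp (η * s) := by
  rcases lt_or_ge s (-t) with hst | hst
  · rw [K.concat_eq_of_lt hf hg hw₀ hfix h ht (hq s hs) hst, add_sub_cancel_right, sub_self,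
      norm_zero]
    positivity
  · rw [K.concat_eq_of_le hf hg hw₀ hfix h ht (hq s hs) hst hs, add_sub_cancel_right, ← map_sub,
      SumState.norm_equiv]
    have h_exp : Real.exp (η * t) * Real.exp (η * s) = Real.exp (η * (s + t)) := by
      rw [← Real.exp_add]; ring_nf
    simpa [mul_assoc, h_exp] using h_bound (s + t) (by linarith)

theorem exists_attraction (K : LyapunovPerronKernels S hε E D η LX LF LS)
    (hf : LipschitzWith lf (onState S.fMod)) (hg : LipschitzWith lg (onState S.g))
    (hL : lf * LX + lg * LF + lg * LS < 1) (hM : 0 ≤ M) (hδ : δ ≤ 1) (hCB : 0 ≤ CB)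
    (hMB : 0 ≤ MB) (hX : μ * ε⁻¹ ≤ η) (hF : βF ≤ η) (hS : η ≤ βS) (hη : η ≤ 0) :
    ∃ C, 0 < C ∧ ∀ (T : ℝ) (u : ℝ → X₁) (vF vS : ℝ → Y₁), IsStrictSolution S ε D T u vF vS →
      ∀ t ∈ Icc 0 T,
        ‖u t - (slowMap S E D η (vS t)).1‖ + ‖vF t - (slowMap S E D η (vS t)).2‖ ≤
          C * Real.exp (η * t) *
            (‖u 0 - (slowMap S E D η (vS 0)).1‖ + ‖vF 0 - (slowMap S E D η (vS 0)).2‖) := by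
  obtain ⟨c, hc, h_bound⟩ := exists_norm_domainOp_add_le E D hε hM hδ hCB hX hF hη
  refine ⟨c / (1 - (lf * LX + lg * LF + lg * LS)), div_pos hc (sub_pos.2 hL),
    fun T u vF vS h t ht => ?_⟩
  have h0 : (0 : ℝ) ∈ Icc 0 T := ⟨le_rfl, ht.1.trans ht.2⟩
  obtain ⟨w₀, hw₀, hfix₀, h_map₀⟩ := K.slowMap_spec hf hg hL hS hMB (h.slow 0 h0)
  obtain ⟨w₁, hw₁, hfix₁, h_map₁⟩ := K.slowMap_spec hf hg hL hS hMB (h.slow t ht)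
  obtain ⟨q, -, hq⟩ := D.exists_slow_orbit (h.slow t ht)
  have hq_flow (s) (hs : s ≤ 0) := (hq s hs).1
  have h_adm₁ := admissible_of_mem_weightedSpace hw₁
  have h_fast : D.IsFast (vF 0 - (w₀ 0).2.1) := by
    have h_fast₀ : D.IsFast (w₀ 0).2.1 := (hw₀.2.1 0 le_rfl).1
    rw [Splitting.IsFast, map_sub, map_sub, h.fast 0 h0, h_fast₀, sub_zero]
  have h_dist := (K.isWeightedLipschitz_op hf hg).norm_sub_le hL
    (admissible_concat hw₀ h ht.2) h_adm₁ (fun s _ => (sub_add_cancel _ _).symm)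
    ((K.isFixedPoint_iff hf hg h_adm₁ hq_flow).1 hfix₁)
    (fun s hs => K.norm_concat_sub_op_le hf hg hw₀ hfix₀ h ht (by positivity)
      (fun r hr => (h_bound _ _ h_fast r hr).trans_eq (mul_right_comm _ _ _)) hq_flow hs) le_rfl
  rw [concat_of_le (neg_nonpos.2 ht.1), zero_add, ← map_sub, SumState.norm_equiv, mul_zero,
    Real.exp_zero, mul_one] at h_dist
  rw [h_map₀, h_map₁]
  calc ‖u t - (w₁ 0).1‖ + ‖vF t - (w₁ 0).2.1‖
      ≤ ‖u t - (w₁ 0).1‖ + ‖vF t - (w₁ 0).2.1‖ + ‖vS t - (w₁ 0).2.2‖ :=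
        le_add_of_nonneg_right (norm_nonneg _)
    _ ≤ _ := h_dist
    _ = _ := by ring

end LyapunovPerronKernels

end Attraction

theorem mul_inv_lt_of_gap {ε ζ μ NF NS : ℝ} (hε : 0 < ε) (hεζ : ε * ζ⁻¹ < 1) (hμ : μ < 0)
    (hNF : 0 ≤ NF) (hN : NF < NS) : μ * ε⁻¹ < ζ⁻¹ * μ + (NS + NF) / 2 := by
  have h_inv : ζ⁻¹ < ε⁻¹ := (lt_inv_mul_iff₀ hε).2 hεζ |>.trans_eq (mul_one _)
  have h_mul : μ * ε⁻¹ < μ * ζ⁻¹ := mul_lt_mul_of_neg_left h_inv hμ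
  linarith

end FastReaction

theorem mainTheorem4_general
    {X X₁ Xγ Y Y₁ Yδ : Type*}
    [NormedAddCommGroup X] [NormedSpace ℝ X] [CompleteSpace X]
    [NormedAddCommGroup X₁] [NormedSpace ℝ X₁] [CompleteSpace X₁]
    [NormedAddCommGroup Xγ] [NormedSpace ℝ Xγ]
    [NormedAddCommGroup Y] [NormedSpace ℝ Y] [CompleteSpace Y]
    [NormedAddCommGroup Y₁] [NormedSpace ℝ Y₁] [CompleteSpace Y₁]
    [NormedAddCommGroup Yδ] [NormedSpace ℝ Yδ]
    (S : FastReaction.System X X₁ Xγ Y Y₁ Yδ) {γ δ μ MA CA MB CB Lf Lg βF βS ε η : ℝ}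
    (hγ : 0 < γ) (hδ : δ ∈ Ioc (0 : ℝ) 1) (hMA : 0 ≤ MA) (hCA : 0 ≤ CA) (hMB : 0 ≤ MB)
    (hCB : 0 ≤ CB) (hLf : 0 ≤ Lf) (hLg : 0 ≤ Lg)
    (hf : ∀ (x₁ x₂ : X₁) (y₁ y₂ : Y₁),
      ‖S.fMod (x₁, y₁) - S.fMod (x₂, y₂)‖ ≤ Lf * (‖x₁ - x₂‖ + ‖y₁ - y₂‖))
    (hg : ∀ (x₁ x₂ : X₁) (y₁ y₂ : Y₁),
      ‖S.g (x₁, y₁) - S.g (x₂, y₂)‖ ≤ Lg * (‖x₁ - x₂‖ + ‖y₁ - y₂‖))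
    (hε : 0 < ε) (E : FastReaction.ModifiedSemigroup S ε γ μ MA CA)
    (D : FastReaction.Splitting S.spY δ βF βS CB MB) (hD : D.P ≠ 0)
    (hX : μ * ε⁻¹ < η) (hF : βF < η) (hS : η < βS)
    (hL : Lf * (CA * ε⁻¹ ^ γ * Real.Gamma γ / (η - μ * ε⁻¹) ^ γ) +
      Lg * (CB * ‖D.prF‖ * Real.Gamma δ / (η - βF) ^ δ) + Lg * (MB * ‖D.Q‖ / (βS - η)) < 1) :
    (∀ y₀ : Y₁, D.IsSlow y₀ →
      ∃ w ∈ FastReaction.weightedSpace X₁ D η, FastReaction.IsFixedPoint S E D y₀ w ∧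
        ∀ w' ∈ FastReaction.weightedSpace X₁ D η, FastReaction.IsFixedPoint S E D y₀ w' →
          EqOn w' w (Iic 0)) ∧
    ∃ C c : ℝ, 0 < C ∧ 0 < c ∧
      ∀ (T : ℝ) (u : ℝ → X₁) (vF vS : ℝ → Y₁),
        FastReaction.IsStrictSolution S ε D T u vF vS →
        ∀ t ∈ Icc 0 T,
          ‖u t - (FastReaction.slowMap S E D η (vS t)).1‖
              + ‖vF t - (FastReaction.slowMap S E D η (vS t)).2‖
            ≤ C * Real.exp (-c * t) *
              (‖u 0 - (FastReaction.slowMap S E D η (vS 0)).1‖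
                + ‖vF 0 - (FastReaction.slowMap S E D η (vS 0)).2‖) := by
  lift Lf to NNReal using hLf
  lift Lg to NNReal using hLg
  replace hf := FastReaction.lipschitzWith_onState hf
  replace hg := FastReaction.lipschitzWith_onState hg
  have hη : η < 0 := hS.trans (D.slowRate_neg hD hMB)
  obtain ⟨K⟩ :=
    FastReaction.nonempty_lyapunovPerronKernels E D hε hγ hδ.1 hCA hCB hMB hX hF hS
  refine ⟨fun y₀ hy => ?_, ?_⟩
  · obtain ⟨w, hw, hfix⟩ := K.exists_isFixedPoint hf hg hL hS.le hMB hy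
    exact ⟨w, hw, hfix, fun w' hw' hfix' => K.eqOn_of_isFixedPoint hf hg hL hy hw hfix hw' hfix'⟩
  · obtain ⟨C, hC, h_attr⟩ :=
      K.exists_attraction hf hg hL hMA hδ.2 hCB hMB hX.le hF.le hS.le hη.le
    exact ⟨C, -η, hC, neg_pos.2 hη, by simpa only [neg_neg] using h_attr⟩


theorem mainTheorem4
    {X X₁ Xγ Y Y₁ Yδ : Type*}
    [NormedAddCommGroup X] [NormedSpace ℝ X] [CompleteSpace X]
    [NormedAddCommGroup X₁] [NormedSpace ℝ X₁] [CompleteSpace X₁]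
    [NormedAddCommGroup Xγ] [NormedSpace ℝ Xγ] [CompleteSpace Xγ]
    [NormedAddCommGroup Y] [NormedSpace ℝ Y] [CompleteSpace Y]
    [NormedAddCommGroup Y₁] [NormedSpace ℝ Y₁] [CompleteSpace Y₁]
    [NormedAddCommGroup Yδ] [NormedSpace ℝ Yδ] [CompleteSpace Yδ]
    (S : FastReaction.System X X₁ Xγ Y Y₁ Yδ)
    (γ δ : ℝ) (hγ : γ ∈ Set.Ioc (0 : ℝ) 1) (hδ : δ ∈ Set.Ioc (0 : ℝ) 1)
    (ωA lam₀ MA CA MB CB Lf Lg NF NS : ℝ)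
    (hlam : lam₀ < 0) (hMA : 0 < MA) (hCA : 0 < CA) (hMB : 0 < MB) (hCB : 0 < CB)
    (hLf : 0 ≤ Lf) (hLg : 0 ≤ Lg) (hNF : 0 ≤ NF) (hN : NF < NS)
    -- Lipschitz continuity of the modified `f` and of `g`
    (hf : ∀ (x₁ x₂ : X₁) (y₁ y₂ : Y₁),
      ‖S.fMod (x₁, y₁) - S.fMod (x₂, y₂)‖ ≤ Lf * (‖x₁ - x₂‖ + ‖y₁ - y₂‖))
    (hg : ∀ (x₁ x₂ : X₁) (y₁ y₂ : Y₁),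
      ‖S.g (x₁, y₁) - S.g (x₂, y₂)‖ ≤ Lg * (‖x₁ - x₂‖ + ‖y₁ - y₂‖))
    -- the two small parameters
    (ε ζ : ℝ) (hε : 0 < ε) (hζ : 0 < ζ) (hεζ : ε * ζ⁻¹ < 1)
    (hμ : ε * ωA + lam₀ < 0)
    -- the semigroup generated by the modified operator, and its bounds
    (E : FastReaction.ModifiedSemigroup S ε γ (ε * ωA + lam₀) MA CA)
    -- the splitting of `Y`, with a nontrivial slow part
    (D : FastReaction.Splitting S.spY δ (NF + ζ⁻¹ * (ε * ωA + lam₀))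
      (NS + ζ⁻¹ * (ε * ωA + lam₀)) CB MB)
    (hD : D.P ≠ 0)
    -- the spectral gap condition
    (hL : FastReaction.gapConst ε ζ (ε * ωA + lam₀) γ δ Lf Lg CA CB MB NF NS ‖D.prF‖ ‖D.Q‖ < 1)
    (η : ℝ) (hη : η = ζ⁻¹ * (ε * ωA + lam₀) + (NS + NF) / 2) :
    -- the slow manifold is well defined ...
    (∀ y₀ : Y₁, D.IsSlow y₀ →
      ∃ w ∈ FastReaction.weightedSpace X₁ D η, FastReaction.IsFixedPoint S E D y₀ w ∧
        ∀ w' ∈ FastReaction.weightedSpace X₁ D η, FastReaction.IsFixedPoint S E D y₀ w' →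
          Set.EqOn w' w (Set.Iic 0)) ∧
    -- ... and attracts all trajectories exponentially
    ∃ C c : ℝ, 0 < C ∧ 0 < c ∧
      ∀ (T : ℝ) (u : ℝ → X₁) (vF vS : ℝ → Y₁),
        FastReaction.IsStrictSolution S ε D T u vF vS →
        ∀ t ∈ Set.Icc 0 T,
          ‖u t - (FastReaction.slowMap S E D η (vS t)).1‖
              + ‖vF t - (FastReaction.slowMap S E D η (vS t)).2‖
            ≤ C * Real.exp (-c * t) *
              (‖u 0 - (FastReaction.slowMap S E D η (vS 0)).1‖
                + ‖vF 0 - (FastReaction.slowMap S E D η (vS 0)).2‖) := by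

  subst hη
  have hX := FastReaction.mul_inv_lt_of_gap hε hεζ hμ hNF hN
  exact mainTheorem4_general S hγ.1 hδ hMA.le hCA.le hMB.le hCB.le hLf hLg hf hg hε E D hD hX
    (by linarith) (by linarith)
    ((FastReaction.contraction_le_gapConst hδ hε hLg hMB.le (norm_nonneg _) hN rfl hX).trans_lt hL)
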